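/- **Setting.** Let $p\ge 1$, $q\ge 0$ be coprime integers, $\omega=e^{2\pi i/p}$, and let $(b_n)_{1\le n\le p+q}$ with $b_{p+q}\ne 0$, $(v_n)_{n\ge1}$ and $(v_{nm})_{n,m\ge 1}$ be complex numbers. All functions are formal series in powers of $\lambda_i=\zeta_i^{1/p}$. For $0\le a,b<p$ put $$Q_a(\zeta)=\frac1p\sum_{n=1}^{p+q}n b_n\omega^{na}\zeta^{n/p-1}+\frac1p\sum_{n\ge1}v_n\omega^{-na}\zeta^{-n/p-1},$$ $$A_{ab}(\zeta_1,\zeta_2)=\frac{\omega^{a+b}\lambda_1\lambda_2}{p^2\zeta_1\zeta_2\,(\omega^a\lambda_1-\omega^b\lambda_2)^2}+\widetilde A_{ab}(\zeta_1,\zeta_2),\qquad \widetilde A_{ab}(\zeta_1,\zeta_2)=\frac1{p^2}\sum_{n,m\ge1}v_{nm}\,\omega^{-na-mb}\zeta_1^{-n/p-1}\zeta_2^{-m/p-1}.$$ The genus-zero connected annulus amplitude is $\langle\partial\varphi_a(\zeta_1)\partial\varphi_b(\zeta_2)\rangle_c^{(0)}=A_{ab}(\zeta_1,\zeta_2)-\delta_{ab}/(\zeta_1-\zeta_2)^2$.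 Functions of $(\zeta_1,\zeta_2)$ are expanded in each of the regions (I) $|\zeta_1|>|\zeta_2|$ and (II) $|\zeta_2|>|\zeta_1|$. Write $[f]_{\rm pol}$ for the part of $f$ with non-negative integer powers of $\zeta$ (of $\zeta_1$ and of $\zeta_2$). Write $[f]_W$ for the part of the expansion of $f$ made of the integer powers $\zeta_1^M\zeta_2^N$ with $M+N\ge-2$ and with $N\ge0$ in region (I), $M\ge 0$ in region (II). Assume the disk Schwinger–Dyson equations $\sum_{a}Q_a^s=p\,[Q_0^s]_{\rm pol}$ for all $s\ge1$, and put $s\,a_s(\zeta):=p\,[Q_0^s]_{\rm pol}$ for $s\ge0$ (so $s\,a_s$ means $p$ for $s=0$), $F(\zeta,Q)=\prod_{a=0}^{p-1}(Q-Q_a(\zeta))$, and $$G_{st}(\zeta_1,\zeta_2)=p^2\big[Q_0^{s-1}(\zeta_1)A_{00}(\zeta_1,\zeta_2)Q_0^{t-1}(\zeta_2)\big]_W,\qquad G^A_{st}(\zeta_1,\zeta_2)=p^2\big[Q_0^{s-1}(\zeta_1)\widetilde A_{00}(\zeta_1,\zeta_2)Q_0^{t-1}(\zeta_2)\big]_{\rm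 pol}.$$ Let $\sigma^{(a)}_n$ and $\Delta^{(a)}(Q)$ be the $n$-th elementary symmetric function and the Vandermonde determinant of $\{Q_c\}_{c\ne a}$, and $\Delta(Q)$ the Vandermonde determinant of $Q_0,\dots,Q_{p-1}$. The annulus Schwinger–Dyson equations are $$\sum_{a,b=0}^{p-1}Q_a^{s-1}(\zeta_1)A_{ab}(\zeta_1,\zeta_2)Q_b^{t-1}(\zeta_2)=G_{st}(\zeta_1,\zeta_2)\quad\text{in both regions},\qquad s,t\ge 1.\tag{SD}$$ **Theorem 7.** 1. In each region, for arbitrary right-hand sides $G_{st}$ ($1\le s,t\le p$), the linear system $\sum_{a,b}Q_a^{s-1}(\zeta_1)A_{ab}Q_b^{t-1}(\zeta_2)=G_{st}$, $1\le s,t\le p$, for unknowns $A_{ab}$ is equivalent to $$A_{ab}=\frac{\Delta^{(a)}(Q(\zeta_1))\,\Delta^{(b)}(Q(\zeta_2))}{\Delta(Q(\zeta_1))\,\Delta(Q(\zeta_2))}\sum_{s,t=1}^p(-1)^{a+b+s+t}\sigma^{(a)}_{p-s}(\zeta_1)\,\sigma^{(b)}_{p-t}(\zeta_2)\,G_{st}\quad(0\le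 a,b<p).\tag{Inv}$$ 2. For all $(v_{nm})$ the following are equivalent: (SD) for all $s,t\ge1$; (SD) for $1\le s,t\le p$; and, in both regions, $\langle\partial\varphi_a\partial\varphi_b\rangle_c^{(0)}=A_{ab}-\delta_{ab}/(\zeta_1-\zeta_2)^2$ for $0\le a,b<p$ with $A_{ab}$ given by the right-hand side of (Inv). 3. There are polynomials $B^N_{st}(\zeta_1,\zeta_2)$, depending only on the disk amplitudes and not on $(v_{nm})$, such that whenever (SD) holds, $G^A_{st}$ is a polynomial in $\zeta_1,\zeta_2$ and, with the polynomials $B_{st}=B^N_{st}+(\zeta_1-\zeta_2)^2G^A_{st}$, for $1\le s,t\le p$ and $0\le a,b<p$, $$G_{st}=\frac1{(\zeta_1-\zeta_2)^2}\Big(\frac{1}{p}\,(s-1)a_{s-1}(\zeta_1)\,(t-1)a_{t-1}(\zeta_2)+B_{st}(\zeta_1,\zeta_2)\Big),$$ $$A_{ab}=\frac{F_{ab}(\zeta_1,\zeta_2)}{(\zeta_1-\zeta_2)^2}\prod_{i\ne a}\frac1{Q_a(\zeta_1)-Q_i(\zeta_1)}\prod_{j\ne b}\frac1{Q_b(\zeta_2)-Q_j(\zeta_2)},$$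 $$F_{ab}=\frac1p\frac{\partial F(\zeta_1,Q_a)}{\partial Q_a}\frac{\partial F(\zeta_2,Q_b)}{\partial Q_b}+\sum_{s,t=1}^p(-1)^{s+t}\sigma^{(a)}_{p-s}(\zeta_1)\,\sigma^{(b)}_{p-t}(\zeta_2)\,B_{st}(\zeta_1,\zeta_2).$$ -/

import Mathlib

namespace Annulus

/-! Formal series at infinity.  With `lam = ζ ^ (1/p)`, a formal Laurent series
`∑ c_k lam ^ k` with `k` bounded above is represented as a Laurent series in `lam ⁻¹`:
the coefficient of `lam ^ k` is `f.coeff (-k)`. -/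

/-- One-variable series `∑ c_k lam ^ k` (`k` bounded above). -/
abbrev Series := LaurentSeries ℂ

/-- Iterated Laurent series: Laurent series in one variable `lam_i ⁻¹` whose coefficients are
Laurent series in the other one. -/
abbrev Double := LaurentSeries (LaurentSeries ℂ)

/-- The two regions of expansion: `I` is `|ζ₁| > |ζ₂|`, `II` is `|ζ₂| > |ζ₁|`.
In region `I` an element of `Double` is a series in `lam₁ ⁻¹` with coefficients that are series
in `lam₂ ⁻¹`, so that for instance `(lam₁ - lam₂) ⁻¹ = ∑_{k ≥ 0} lam₂ ^ k lam₁ ^ (-k-1)`.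
In region `II` the roles of the variables are exchanged. -/
inductive Region
  | I
  | II

/-- A series in the outer variable, seen as a double series. -/
noncomputable def outer (f : Series) : Double :=
  f.map (HahnSeries.C : ℂ →+* LaurentSeries ℂ)

/-- A series in the inner variable, seen as a double series. -/
noncomputable def inner (f : Series) : Double :=
  HahnSeries.C f

/-- `f(ζ₁)` as a double series. -/
noncomputable def at1 (R : Region) (f : Series) : Double :=
  match R with
  | .I => outer f
  | .II => inner f

/-- `f(ζ₂)` as a double series. -/
noncomputable def at2 (R : Region) (f : Series) : Double :=
  match R with
  | .I => inner f
  | .II => outer f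

/-- The double series `∑_{n, m ≥ 0} c n m lam₁ ^ (-n) lam₂ ^ (-m)`. -/
noncomputable def twoVar (R : Region) (c : ℕ → ℕ → ℂ) : Double :=
  HahnSeries.ofPowerSeries ℤ (LaurentSeries ℂ) (PowerSeries.mk fun i =>
    HahnSeries.ofPowerSeries ℤ ℂ (PowerSeries.mk fun j =>
      match R with
      | .I => c i j
      | .II => c j i))

open Classical in
/-- Keep the terms of a Laurent series whose exponents satisfy `P`. -/
noncomputable def keep {A : Type} [Zero A] (P : ℤ → Prop) (f : LaurentSeries A) :
    LaurentSeries A where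
  coeff k := if P k then f.coeff k else 0
  isPWO_support' := f.isPWO_support.mono fun k hk => by
    by_contra h
    simp only [HahnSeries.mem_support, not_not] at h
    simp [h] at hk

/-- Keep the terms of an iterated Laurent series whose pair of exponents (outer, inner)
satisfies `P`. -/
noncomputable def keepPair (P : ℤ → ℤ → Prop) (f : Double) : Double where
  coeff i := keep (P i) (f.coeff i)
  isPWO_support' := f.isPWO_support.mono fun k hk => by
    by_contra h
    simp only [HahnSeries.mem_support, not_not] at h
    apply hk
    ext j
    simp [h, keep]

/-- The part of a double series made of the terms `lam₁ ^ k lam₂ ^ l` with `P k l`. -/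
noncomputable def part (R : Region) (P : ℤ → ℤ → Prop) (f : Double) : Double :=
  match R with
  | .I => keepPair (fun i j => P (-i) (-j)) f
  | .II => keepPair (fun i j => P (-j) (-i)) f

/-- The polynomial part `[f]_pol`: the terms `ζ ^ l = lam ^ (p l)` with `l ≥ 0`. -/
noncomputable def polPart (p : ℕ) (f : Series) : Series :=
  keep (fun i => ∃ l : ℕ, -i = (p : ℤ) * l) f

/-- The polynomial part in two variables: the terms `ζ₁ ^ M ζ₂ ^ N` with `M, N ≥ 0`. -/
noncomputable def polPart2 (R : Region) (p : ℕ) (f : Double) : Double :=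
  part R (fun k l => ∃ M N : ℕ, k = (p : ℤ) * M ∧ l = (p : ℤ) * N) f

/-- The exponents allowed by the `W_{1+∞}` constraints for `ζ₁ ^ M ζ₂ ^ N` in each region. -/
def WAllowed (R : Region) (M N : ℤ) : Prop :=
  match R with
  | .I => 0 ≤ N ∧ -2 ≤ M + N
  | .II => 0 ≤ M ∧ -2 ≤ M + N

/-- `[f]_W`: the terms with integer powers `ζ₁ ^ M ζ₂ ^ N` that are allowed by the
`W_{1+∞}` constraints in the region. -/
noncomputable def wPart (R : Region) (p : ℕ) (f : Double) : Double :=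
  part R (fun k l => ∃ M N : ℤ, k = (p : ℤ) * M ∧ l = (p : ℤ) * N ∧ WAllowed R M N) f

/-- The series `lam ^ k`. -/
noncomputable def lamPow (k : ℤ) : Series := HahnSeries.single (-k) 1

noncomputable def lam1 (R : Region) : Double := at1 R (lamPow 1)
noncomputable def lam2 (R : Region) : Double := at2 R (lamPow 1)
noncomputable def zeta1 (R : Region) (p : ℕ) : Double := at1 R (lamPow p)
noncomputable def zeta2 (R : Region) (p : ℕ) : Double := at2 R (lamPow p)

/-- `ω = exp (2 π i / p)`. -/
noncomputable def omega (p : ℕ) : ℂ := Complex.exp (2 * Real.pi * Complex.I / p)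

/-- A constant as a double series. -/
noncomputable def const2 (c : ℂ) : Double := HahnSeries.C (HahnSeries.C c)

/-! Disk amplitudes. -/

/-- The disk amplitude on the `a`-th sheet,
`Q_a(ζ) = (1/p) ∑_{n=1}^{p+q} n b_n ω^{na} ζ^{n/p-1} + (1/p) ∑_{n≥1} v_n ω^{-na} ζ^{-n/p-1}`,
that is `Q_0(e^{2πia} ζ)`. -/
noncomputable def diskQ (p q : ℕ) (b v : ℕ → ℂ) (a : ℕ) : Series :=
  HahnSeries.C ((p : ℂ)⁻¹) *
    (∑ n ∈ Finset.Icc 1 (p + q),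
        HahnSeries.C ((n : ℂ) * b n * omega p ^ (n * a)) * lamPow ((n : ℤ) - p)
      + lamPow (-(p : ℤ)) * HahnSeries.ofPowerSeries ℤ ℂ (PowerSeries.mk fun n =>
          if n = 0 then 0 else v n * (omega p)⁻¹ ^ (n * a)))

/-- `s a_s(ζ) = p [Q_0(ζ)^s]_pol` (for `s = 0` this is `p`). -/
noncomputable def sa (p : ℕ) (Q : ℕ → Series) (s : ℕ) : Series :=
  (p : Series) * polPart p (Q 0 ^ s)

/-- The Schwinger–Dyson equations of the disk amplitude:
`∑_a Q_a^s = p [Q_0^s]_pol` for all `s ≥ 1`. -/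
def DiskSD (p : ℕ) (Q : ℕ → Series) : Prop :=
  ∀ s : ℕ, 1 ≤ s → ∑ a ∈ Finset.range p, Q a ^ s = sa p Q s

/-- `F(ζ, Q) = ∏_a (Q - Q_a(ζ))`, as a polynomial in `Q`. -/
noncomputable def curveF (p : ℕ) (Q : ℕ → Series) : Polynomial Series :=
  ∏ a ∈ Finset.range p, (Polynomial.X - Polynomial.C (Q a))

/-- `∂F(ζ, Q_a)/∂Q_a`. -/
noncomputable def curveF' (p : ℕ) (Q : ℕ → Series) (a : ℕ) : Series :=
  (Polynomial.derivative (curveF p Q)).eval (Q a)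

/-- The elementary symmetric function of degree `n` of `{Q_b : b ≠ a}`. -/
noncomputable def sigma (p : ℕ) (Q : ℕ → Series) (a n : ℕ) : Series :=
  ∑ S ∈ ((Finset.range p).erase a).powersetCard n, ∏ i ∈ S, Q i

/-- The Vandermonde determinant of `Q_0, …, Q_{p-1}`. -/
noncomputable def vdm (p : ℕ) (Q : ℕ → Series) : Series :=
  (Matrix.vandermonde fun i : Fin p => Q i).det

/-- The Vandermonde determinant of `Q_0, …, Q_{p-1}` with `Q_a` omitted. -/
noncomputable def vdmErase (p : ℕ) (Q : ℕ → Series) (a : ℕ) : Series :=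
  (Matrix.vandermonde fun i : Fin (p - 1) => Q (if (i : ℕ) < a then i else i + 1)).det

/-! Annulus amplitudes. -/

/-- The universal part
`p⁻² ∑_{n,m≥1} v_{nm} ω^{-na-mb} ζ₁^{-n/p-1} ζ₂^{-m/p-1}`; `w n m` stands for `v_{nm}`. -/
noncomputable def universalPart (R : Region) (p : ℕ) (w : ℕ → ℕ → ℂ) (a b : ℕ) : Double :=
  (((p : Double) ^ 2)⁻¹ * (zeta1 R p)⁻¹ * (zeta2 R p)⁻¹) *
    twoVar R fun n m =>
      if n = 0 ∨ m = 0 then 0 else w n m * (omega p)⁻¹ ^ (n * a) * (omega p)⁻¹ ^ (m * b)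

/-- `(d lam_{1,a}/dζ₁)(d lam_{2,b}/dζ₂) / (lam_{1,a} - lam_{2,b})²` with
`lam_{i,a} = ω^a lam_i`, `d lam_{i,a}/dζ_i = lam_{i,a} / (p ζ_i)`. -/
noncomputable def kernelPart (R : Region) (p : ℕ) (a b : ℕ) : Double :=
  let l1 := const2 (omega p ^ a) * lam1 R
  let l2 := const2 (omega p ^ b) * lam2 R
  (l1 / ((p : Double) * zeta1 R p)) * (l2 / ((p : Double) * zeta2 R p)) / (l1 - l2) ^ 2

/-- `δ_{ab} / (ζ₁ - ζ₂)²`. -/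
noncomputable def deltaPart (R : Region) (p : ℕ) (a b : ℕ) : Double :=
  if a = b then 1 / (zeta1 R p - zeta2 R p) ^ 2 else 0

/-- The genus-zero connected annulus amplitude `⟨∂φ_a(ζ₁) ∂φ_b(ζ₂)⟩_c^{(0)}`. -/
noncomputable def conn (R : Region) (p : ℕ) (w : ℕ → ℕ → ℂ) (a b : ℕ) : Double :=
  kernelPart R p a b - deltaPart R p a b + universalPart R p w a b

/-- `A_{ab} = ⟨∂φ_a ∂φ_b⟩_c^{(0)} + δ_{ab}/(ζ₁-ζ₂)²`. -/
noncomputable def ampA (R : Region) (p : ℕ) (w : ℕ → ℕ → ℂ) (a b : ℕ) : Double :=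
  conn R p w a b + deltaPart R p a b

/-- `G_{st} = p² [Q_0(ζ₁)^{s-1} A_{00}(ζ₁,ζ₂) Q_0(ζ₂)^{t-1}]_W`. -/
noncomputable def ampG (R : Region) (p : ℕ) (Q : ℕ → Series) (w : ℕ → ℕ → ℂ) (s t : ℕ) :
    Double :=
  (p : Double) ^ 2 *
    wPart R p (at1 R (Q 0) ^ (s - 1) * ampA R p w 0 0 * at2 R (Q 0) ^ (t - 1))

/-- `G^A_{st}`: the polynomial part of `p² Q_0(ζ₁)^{s-1} Ã(ζ₁,ζ₂) Q_0(ζ₂)^{t-1}`,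
where `Ã` is the universal part of `A_{00}`. -/
noncomputable def ampGA (R : Region) (p : ℕ) (Q : ℕ → Series) (w : ℕ → ℕ → ℂ) (s t : ℕ) :
    Double :=
  (p : Double) ^ 2 *
    polPart2 R p (at1 R (Q 0) ^ (s - 1) * universalPart R p w 0 0 * at2 R (Q 0) ^ (t - 1))

/-- `∑_{a,b} Q_a(ζ₁)^{s-1} A_{ab}(ζ₁,ζ₂) Q_b(ζ₂)^{t-1}`. -/
noncomputable def sheetSum (R : Region) (p : ℕ) (Q : ℕ → Series) (A : ℕ → ℕ → Double)
    (s t : ℕ) : Double :=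
  ∑ a ∈ Finset.range p, ∑ b ∈ Finset.range p,
    at1 R (Q a) ^ (s - 1) * A a b * at2 R (Q b) ^ (t - 1)

/-- The Schwinger–Dyson equation of the annulus amplitudes for the pair `(s, t)`, in both
regions: `∑_{a,b} Q_a(ζ₁)^{s-1} A_{ab}(ζ₁,ζ₂) Q_b(ζ₂)^{t-1} = G_{st}(ζ₁,ζ₂)`. -/
def AnnulusSD (p : ℕ) (Q : ℕ → Series) (w : ℕ → ℕ → ℂ) (s t : ℕ) : Prop :=
  ∀ R : Region, sheetSum R p Q (ampA R p w) s t = ampG R p Q w s t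

/-- The right-hand side of the inversion formula, for given functions `G_{st}`:
`Δ^{(a)}(Q(ζ₁)) Δ^{(b)}(Q(ζ₂)) / (Δ(Q(ζ₁)) Δ(Q(ζ₂)))
  ∑_{s,t=1}^p (-1)^{a+b+s+t} σ^{(a)}_{p-s}(ζ₁) σ^{(b)}_{p-t}(ζ₂) G_{st}(ζ₁,ζ₂)`. -/
noncomputable def inversion (R : Region) (p : ℕ) (Q : ℕ → Series) (G : ℕ → ℕ → Double)
    (a b : ℕ) : Double :=
  (at1 R (vdmErase p Q a) * at2 R (vdmErase p Q b)) / (at1 R (vdm p Q) * at2 R (vdm p Q)) *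
    ∑ s ∈ Finset.Icc 1 p, ∑ t ∈ Finset.Icc 1 p,
      (-1) ^ (a + b + s + t) * at1 R (sigma p Q a (p - s)) * at2 R (sigma p Q b (p - t)) *
        G s t

/-- The value of a polynomial in two variables at `(ζ₁, ζ₂)`. -/
noncomputable def evalZeta (R : Region) (p : ℕ) (B : MvPolynomial (Fin 2) ℂ) : Double :=
  MvPolynomial.eval₂ ((HahnSeries.C : LaurentSeries ℂ →+* Double).comp HahnSeries.C)
    ![zeta1 R p, zeta2 R p] B

/-- `F_{ab} = (1/p) ∂F(ζ₁,Q_a)/∂Q_a ∂F(ζ₂,Q_b)/∂Q_b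
  + ∑_{s,t} (-1)^{s+t} σ^{(a)}_{p-s}(ζ₁) σ^{(b)}_{p-t}(ζ₂) B_{st}(ζ₁,ζ₂)`. -/
noncomputable def ampF (R : Region) (p : ℕ) (Q : ℕ → Series)
    (B : ℕ → ℕ → MvPolynomial (Fin 2) ℂ) (a b : ℕ) : Double :=
  (p : Double)⁻¹ * at1 R (curveF' p Q a) * at2 R (curveF' p Q b) +
    ∑ s ∈ Finset.Icc 1 p, ∑ t ∈ Finset.Icc 1 p,
      (-1) ^ (s + t) * at1 R (sigma p Q a (p - s)) * at2 R (sigma p Q b (p - t)) *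
        evalZeta R p (B s t)

end Annulus

/-! All sheets are rotations of sheet 0: `Q_a` and `A_ab` arise from `Q_0` and `A_00` by λ₁ ↦ ω^a
λ₁, λ₂ ↦ ω^b λ₂. Summing over the sheets is therefore a roots-of-unity filter: the sheet sum is p²
times the integer-power part of `Q_0^(s-1) A_00 Q_0^(t-1)` (`c2_pairing`). Consequently (SD) for the
pair (s, t) says exactly that the sheet sum contains no exponent forbidden by `WAllowed`
(`annulusSD_iff`).

Inversion. The coefficient of λ^q in `Q_a` is a nonzero number times ω^(aq), and q is prime to p, so
the sheets are distinct (`diskQ_distinct`). The Vandermonde matrix is then invertible, with the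
Lagrange coefficients as inverse; the ratio of determinants times σ is that inverse up to a common
sign (`vdmErase_div_vdm`, `sheetSum_eq_iff`).

Finitely many equations suffice. By the disk equations the power sums of the sheets are polynomials
in ζ, so Newton's identities give a monic equation of degree p for all sheets with polynomial
coefficients (`exists_sheet_relation`). Allowed exponents stay allowed after multiplication by such
coefficients, so the cases s, t ≤ p propagate to all s, t (`pairing_mem_of_small`).

Structure. Multiplying by (ζ₁ - ζ₂)² clears the double pole, after which both regions have the same
coefficients (`Reg`). Region I forbids negative powers of ζ₂ and region II those of ζ₁, so (ζ₁ -
ζ₂)² G_st is a polynomial. For two solutions the kernel cancels in the difference, which is then a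
polynomial itself and equals the difference of the `G^A` (`ampPairing_sub_eq`); hence one solution
determines a `B^N` valid for all. Finally, the disk term inverts to the constant 1/p, since Lagrange
interpolation of power sums of the sheets gives 1 (`sum_lagr_mul_sa`). -/

namespace Annulus

/-! ### Lagrange interpolation and Vandermonde determinants on the sheets -/

section Interpolation

variable (p : ℕ) (Q : ℕ → Series)

/-- The sheets `Q_0, …, Q_{p-1}` are pairwise distinct. -/
def Distinct : Prop := ∀ a < p, ∀ b < p, Q a = Q b → a = b

/-- The coefficient of `x ^ (s - 1)` in the Lagrange polynomial
`∏_{c ≠ a} (x - Q_c) / (Q_a - Q_c)`. -/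
noncomputable def lagrangeCoeff (a s : ℕ) : Series :=
  (-1) ^ (p - s) * sigma p Q a (p - s) * (∏ c ∈ (Finset.range p).erase a, (Q a - Q c))⁻¹

variable {p Q}

theorem sum_sigma_mul_pow {a : ℕ} (ha : a < p) (x : Series) :
    ∑ s ∈ Finset.Icc 1 p, (-1) ^ (p - s) * sigma p Q a (p - s) * x ^ (s - 1) =
      ∏ c ∈ (Finset.range p).erase a, (x - Q c) := by
  have hcard : ((Finset.range p).erase a).card = p - 1 := by
    rw [Finset.card_erase_of_mem (Finset.mem_range.2 ha), Finset.card_range]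
  have h1 : ∏ c ∈ (Finset.range p).erase a, (x - Q c) =
      ∏ c ∈ (Finset.range p).erase a, (-Q c + x) :=
    Finset.prod_congr rfl fun c _ => by ring
  rw [h1, Finset.prod_add, Finset.sum_powerset, hcard, Nat.sub_add_cancel (by omega)]
  -- The coefficient of x^(s-1) collects the subsets of size j = p - s; j runs over 0, …, p - 1.
  refine Finset.sum_bij' (fun s _ => p - s) (fun j _ => p - j) ?_ ?_ ?_ ?_ ?_
  · intro s hs; simp at *; omega
  · intro s hs; simp at *; omega
  · intro s hs; simp at *; omega
  · intro s hs; simp at *; omega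
  · intro s hs
    simp only [Finset.mem_Icc] at hs
    rw [sigma, Finset.mul_sum, Finset.sum_mul]
    refine Finset.sum_congr rfl fun S hS => ?_
    obtain ⟨hS, hSc⟩ := Finset.mem_powersetCard.1 hS
    simp_rw [neg_eq_neg_one_mul (Q _)]
    rw [Finset.prod_mul_distrib, Finset.prod_const, Finset.prod_const,
      Finset.card_sdiff_of_subset hS, hcard, hSc, show p - 1 - (p - s) = s - 1 by omega]

theorem prod_sub_ne_zero (h : Distinct p Q) {a : ℕ} (ha : a < p) :
    ∏ c ∈ (Finset.range p).erase a, (Q a - Q c) ≠ 0 := by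
  refine Finset.prod_ne_zero_iff.2 fun c hc h0 => ?_
  obtain ⟨hca, hc⟩ := Finset.mem_erase.1 hc
  exact hca (h a ha c (Finset.mem_range.1 hc) (sub_eq_zero.1 h0)).symm

theorem sum_lagrangeCoeff_mul_pow (h : Distinct p Q) {a c : ℕ} (ha : a < p) (hc : c < p) :
    ∑ s ∈ Finset.Icc 1 p, lagrangeCoeff p Q a s * Q c ^ (s - 1) = if a = c then 1 else 0 := by
  have h1 : ∑ s ∈ Finset.Icc 1 p, lagrangeCoeff p Q a s * Q c ^ (s - 1) =
      (∑ s ∈ Finset.Icc 1 p, (-1) ^ (p - s) * sigma p Q a (p - s) * Q c ^ (s - 1)) *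
        (∏ c ∈ (Finset.range p).erase a, (Q a - Q c))⁻¹ := by
    rw [Finset.sum_mul]
    exact Finset.sum_congr rfl fun s _ => by rw [lagrangeCoeff]; ring
  rw [h1, sum_sigma_mul_pow ha]
  split_ifs with hac
  · subst hac
    exact mul_inv_cancel₀ (prod_sub_ne_zero h ha)
  · rw [Finset.prod_eq_zero (i := c), zero_mul]
    · exact Finset.mem_erase.2 ⟨fun e => hac e.symm, Finset.mem_range.2 hc⟩
    · exact sub_self _

theorem sum_Icc_eq_sum_fin {M : Type*} [AddCommMonoid M] (f : ℕ → M) :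
    ∑ s ∈ Finset.Icc 1 p, f s = ∑ s : Fin p, f (s + 1) := by
  rw [← Finset.sum_range fun i => f (i + 1)]
  refine Finset.sum_bij' (fun s _ => s - 1) (fun j _ => j + 1) ?_ ?_ ?_ ?_ ?_ <;>
    intro s hs <;> simp only [Finset.mem_Icc, Finset.mem_range] at *
  · omega
  · omega
  · omega
  · omega
  · rw [Nat.sub_add_cancel hs.1]

/-- A one-sided inverse of a square matrix is two-sided, so the interpolation identity can be read
in the other order. -/
theorem sum_pow_mul_lagrangeCoeff (h : Distinct p Q) {s t : ℕ} (hs : s ∈ Finset.Icc 1 p)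
    (ht : t ∈ Finset.Icc 1 p) :
    ∑ a ∈ Finset.range p, Q a ^ (s - 1) * lagrangeCoeff p Q a t = if s = t then 1 else 0 := by
  let L : Matrix (Fin p) (Fin p) Series := Matrix.of fun a s => lagrangeCoeff p Q a (s + 1)
  let V : Matrix (Fin p) (Fin p) Series := Matrix.of fun s a => Q a ^ (s : ℕ)
  have h1 : L * V = 1 := by
    ext a c : 2
    have := sum_lagrangeCoeff_mul_pow h a.2 c.2
    rw [sum_Icc_eq_sum_fin] at this
    simp only [Matrix.mul_apply, L, V, Matrix.of_apply, Matrix.one_apply]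
    simpa [Fin.ext_iff] using this
  have h2 := mul_eq_one_comm.1 h1
  rw [Finset.mem_Icc] at hs ht
  have h3 := congrFun (congrFun h2 ⟨s - 1, by omega⟩) ⟨t - 1, by omega⟩
  simp only [Matrix.mul_apply, L, V, Matrix.of_apply, Matrix.one_apply, Fin.mk.injEq] at h3
  rw [Nat.sub_add_cancel ht.1] at h3
  rw [Finset.sum_range, h3]
  exact if_congr (by omega) rfl rfl

/-- Moving `Q_a` to the front of the list is a cycle of sign (-1)^a; the differences with the first
entry then split off from the Vandermonde product. -/
theorem vdm_eq {a : ℕ} (ha : a < p) :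
    (-1) ^ a * vdm p Q = vdmErase p Q a * ∏ c ∈ (Finset.range p).erase a, (Q c - Q a) := by
  obtain ⟨n, rfl⟩ : ∃ n, p = n + 1 := ⟨p - 1, by omega⟩
  let i : Fin (n + 1) := ⟨a, ha⟩
  have h1 := Matrix.det_permute (i.cycleRange.symm) (Matrix.vandermonde fun i : Fin (n + 1) => Q i)
  have h2 : (Matrix.vandermonde fun i : Fin (n + 1) => Q i).submatrix i.cycleRange.symm id =
      Matrix.vandermonde fun j => Q (i.cycleRange.symm j) := rfl
  rw [h2, Equiv.Perm.sign_symm, Fin.sign_cycleRange] at h1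
  rw [Matrix.det_vandermonde, Fin.prod_univ_succ] at h1
  simp only [Fin.prod_Ioi_zero, Fin.prod_Ioi_succ, Fin.cycleRange_symm_succ,
    Fin.cycleRange_symm_zero] at h1
  rw [vdm, vdmErase]
  have h3 : (fun j : Fin (n + 1 - 1) => Q (if (j : ℕ) < a then j else j + 1)) =
      fun j : Fin n => Q (i.succAbove j) := by
    funext j
    congr 1
    simp only [Fin.succAbove, Fin.lt_def, Fin.val_castSucc, i]
    split_ifs <;> simp
  have h4 : ∏ c ∈ (Finset.range (n + 1)).erase a, (Q c - Q a) =
      ∏ j : Fin n, (Q (i.succAbove j) - Q i) := by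
    have h5 : (Finset.range (n + 1)).erase a =
        (Finset.univ.erase i).map Fin.valEmbedding := by
      ext c
      simp only [Finset.mem_erase, Finset.mem_range, Finset.mem_map, Finset.mem_univ, and_true,
        Fin.valEmbedding_apply]
      constructor
      · rintro ⟨hca, hc⟩
        exact ⟨⟨c, hc⟩, fun e => hca (congrArg Fin.val e), rfl⟩
      · rintro ⟨j, hj, rfl⟩
        exact ⟨fun e => hj (Fin.ext e), j.2⟩
    have h6 : Finset.univ.erase i = Finset.univ.map i.succAboveEmb := by
      rw [Fin.univ_succAbove n i, Finset.erase_cons]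
    rw [h5, Finset.prod_map, h6, Finset.prod_map]
    rfl
  rw [h4, h3, mul_comm (Matrix.det _)]
  rw [Matrix.det_vandermonde] at h1
  simp only [Matrix.det_vandermonde]
  push_cast at h1
  exact h1.symm

theorem vdm_ne_zero (h : Distinct p Q) : vdm p Q ≠ 0 :=
  Matrix.det_vandermonde_ne_zero_iff.2 fun i j hij => Fin.ext (h i i.2 j j.2 hij)

/-- The remaining sign depends on neither `a` nor `s`. It occurs once for ζ₁ and once for ζ₂ in the
inversion formula, and so disappears there. -/
theorem vdmErase_div_vdm (h : Distinct p Q) {a s : ℕ} (ha : a < p) (hs : s ≤ p) :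
    (-1) ^ (a + s) * (vdmErase p Q a / vdm p Q) * sigma p Q a (p - s) =
      (-1) ^ (p - 1 + p) * lagrangeCoeff p Q a s := by
  have h0 := vdm_ne_zero h
  have h1 := prod_sub_ne_zero h ha
  have hcard : ((Finset.range p).erase a).card = p - 1 := by
    rw [Finset.card_erase_of_mem (Finset.mem_range.2 ha), Finset.card_range]
  have h2 : ∏ c ∈ (Finset.range p).erase a, (Q c - Q a) =
      (-1) ^ (p - 1) * ∏ c ∈ (Finset.range p).erase a, (Q a - Q c) := by
    rw [← hcard, ← Finset.prod_const, ← Finset.prod_mul_distrib]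
    exact Finset.prod_congr rfl fun c _ => by ring
  have h3 := vdm_eq (Q := Q) ha
  rw [h2] at h3
  have e1 : ∀ n : ℕ, ((-1 : Series) ^ n) * (-1) ^ n = 1 := fun n => by
    rw [← mul_pow, show (-1 : Series) * -1 = 1 by ring, one_pow]
  have h4 : (-1 : Series) ^ p = (-1) ^ (p - s) * (-1) ^ s := by
    rw [← pow_add, Nat.sub_add_cancel hs]
  have h5 : vdmErase p Q a / vdm p Q =
      (-1) ^ a * (-1) ^ (p - 1) * (∏ c ∈ (Finset.range p).erase a, (Q a - Q c))⁻¹ := by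
    rw [div_eq_iff h0, eq_comm]
    calc _ = (-1) ^ (p - 1) * (∏ c ∈ (Finset.range p).erase a, (Q a - Q c))⁻¹ *
          ((-1) ^ a * vdm p Q) := by ring
      _ = (-1) ^ (p - 1) * (-1) ^ (p - 1) * vdmErase p Q a *
          ((∏ c ∈ (Finset.range p).erase a, (Q a - Q c))⁻¹ *
            ∏ c ∈ (Finset.range p).erase a, (Q a - Q c)) := by rw [h3]; ring
      _ = _ := by rw [inv_mul_cancel₀ h1, e1]; ring
  rw [h5, lagrangeCoeff, pow_add, pow_add, h4]
  linear_combination ((-1) ^ s * (-1) ^ (p - 1) *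
    (∏ c ∈ (Finset.range p).erase a, (Q a - Q c))⁻¹ * sigma p Q a (p - s)) *
      (e1 a - e1 (p - s))

end Interpolation

/-! ### Coefficients and homomorphisms of Laurent series -/

section Generic

open HahnSeries

variable {A B : Type*}

/-- Apply a ring homomorphism to the coefficients of a Laurent series and scale the `k`-th
coefficient by `u ^ (-k)`. -/
noncomputable def scale [CommRing A] [CommRing B] (ψ : A →+* B) (u : Bˣ) :
    HahnSeries ℤ A →+* HahnSeries ℤ B where
  toFun f :=
    { coeff := fun k => ↑(u ^ (-k)) * ψ (f.coeff k)
      isPWO_support' := f.isPWO_support.mono fun k hk => by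
        rw [Function.mem_support] at hk
        rw [HahnSeries.mem_support]
        intro h
        rw [h, map_zero, mul_zero] at hk
        exact hk rfl }
  map_zero' := by ext; simp
  map_one' := by
    ext k
    simp only [coeff_one]
    split_ifs with h
    · simp [h]
    · simp
  map_add' f g := by ext k; simp [mul_add]
  map_mul' f g := by
    ext k
    simp only [coeff_mul, map_sum, map_mul, Finset.mul_sum]
    have hk : ∀ ij ∈ Finset.antidiagonal f.isPWO_support g.isPWO_support k,
        ((u ^ (-k) : Bˣ) : B) * (ψ (f.coeff ij.1) * ψ (g.coeff ij.2)) =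
        (↑(u ^ (-ij.1)) * ψ (f.coeff ij.1)) * (↑(u ^ (-ij.2)) * ψ (g.coeff ij.2)) := by
      intro ij hij
      rw [← (Finset.mem_antidiagonal.1 hij).2.2, neg_add, zpow_add, Units.val_mul]
      ring
    rw [Finset.sum_congr rfl hk]
    -- Applying ψ and scaling can only shrink the supports; the extra index pairs contribute zero.
    refine (Finset.sum_subset (fun ij h => ?_) (fun ij h hn => ?_)).symm
    · simp only [Finset.mem_antidiagonal, mem_support] at h ⊢
      exact ⟨fun e => h.1 (by rw [e]; simp), fun e => h.2.1 (by rw [e]; simp), h.2.2⟩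
    · simp only [Finset.mem_antidiagonal, mem_support] at h hn
      by_cases h1 : (↑(u ^ (-ij.1)) * ψ (f.coeff ij.1)) = 0
      · rw [h1, zero_mul]
      · by_cases h2 : (↑(u ^ (-ij.2)) * ψ (g.coeff ij.2)) = 0
        · rw [h2, mul_zero]
        · exact absurd ⟨h1, h2, h.2.2⟩ hn

theorem coeff_scale [CommRing A] [CommRing B] (ψ : A →+* B) (u : Bˣ) (f : HahnSeries ℤ A) (k : ℤ) :
    (scale ψ u f).coeff k = ↑(u ^ (-k)) * ψ (f.coeff k) := rfl

theorem exists_of_coeff_mul_ne_zero [CommRing A] [AddCommMonoid B] {f g : HahnSeries ℤ A}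
    {k : ℤ} (φ : A →+ B) (h : φ ((f * g).coeff k) ≠ 0) :
    ∃ i j, i + j = k ∧ φ (f.coeff i * g.coeff j) ≠ 0 := by
  rw [coeff_mul, map_sum] at h
  obtain ⟨ij, hij, h⟩ := Finset.exists_ne_zero_of_sum_ne_zero h
  exact ⟨ij.1, ij.2, (Finset.mem_antidiagonal.1 hij).2.2, h⟩

/-- Replaces the support-dependent index set by an interval depending only on K and k, so that
products computed in the two regions can be compared. -/
theorem coeff_mul_of_lower_bound [CommRing A] {f g : HahnSeries ℤ A} {K : ℤ}
    (hf : ∀ i, f.coeff i ≠ 0 → -K ≤ i) (hg : ∀ i, g.coeff i ≠ 0 → -K ≤ i) (k : ℤ) :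
    (f * g).coeff k = ∑ i ∈ Finset.Icc (-K) (k + K), f.coeff i * g.coeff (k - i) := by
  rw [coeff_mul]
  refine Finset.sum_of_injOn Prod.fst ?_ ?_ ?_ ?_
  · rintro ⟨i, j⟩ h ⟨i', j'⟩ h' (e : i = i')
    have h := (Finset.mem_antidiagonal.1 h).2.2
    have h' := (Finset.mem_antidiagonal.1 h').2.2
    simp only at h h'
    ext <;> simp only <;> omega
  · rintro ⟨i, j⟩ h
    obtain ⟨h1, h2, h3⟩ := Finset.mem_antidiagonal.1 h
    have h1 := hf i h1
    have h2 := hg j h2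
    simp only at h3
    simp only [Finset.coe_Icc, Set.mem_Icc]
    omega
  · intro i _ hi
    by_contra hne
    refine hi ⟨(i, k - i), ?_, rfl⟩
    refine Finset.mem_coe.2 (Finset.mem_antidiagonal.2 ⟨?_, ?_, by simp⟩)
    · exact fun e => hne (by rw [show f.coeff i = 0 from e, zero_mul])
    · exact fun e => hne (by rw [show g.coeff (k - i) = 0 from e, mul_zero])
  · rintro ⟨i, j⟩ h
    obtain ⟨-, -, h3⟩ := Finset.mem_antidiagonal.1 h
    simp only at h3 ⊢
    rw [← h3, add_sub_cancel_left]

theorem coeff_ofPowerSeries_mk [CommRing A] (c : ℕ → A) (i : ℤ) :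
    (ofPowerSeries ℤ A (PowerSeries.mk c)).coeff i = if 0 ≤ i then c i.toNat else 0 := by
  split_ifs with h
  · lift i to ℕ using h
    rw [show ((i : ℤ)) = ((i : ℕ) : ℤ) from rfl, ofPowerSeries_apply_coeff]
    simp
  · rw [ofPowerSeries_apply, embDomain_of_notMem_range]
    rintro ⟨n, hn⟩
    apply h
    rw [← hn]
    exact Int.natCast_nonneg n

end Generic

/-! ### Coefficient functionals and the two embeddings -/

/-- One-variable series, with a field structure that is opaque to unification. -/
def Ser : Type := Series

noncomputable instance : Field Ser := inferInstanceAs (Field Series)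

/-- Double series, with a field structure that is opaque to unification. -/
def Dbl : Type := Double

noncomputable instance : Field Dbl := inferInstanceAs (Field Double)

/-- A series, as an element of the field `Ser`. -/
def toSer (f : Series) : Ser := f

/-- A double series, as an element of the field `Dbl`. -/
def toDbl (f : Double) : Dbl := f

/-- The coefficient of `lam ^ k`. -/
noncomputable def c1 (k : ℤ) : Ser →+ ℂ where
  toFun f := HahnSeries.coeff (f : Series) (-k)
  map_zero' := rfl
  map_add' _ _ := rfl

/-- The coefficient of `lam₁ ^ k lam₂ ^ l`. -/
noncomputable def c2 (R : Region) (k l : ℤ) : Dbl →+ ℂ where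
  toFun f := match R with
    | .I => HahnSeries.coeff (HahnSeries.coeff (f : Double) (-k)) (-l)
    | .II => HahnSeries.coeff (HahnSeries.coeff (f : Double) (-l)) (-k)
  map_zero' := by cases R <;> rfl
  map_add' _ _ := by cases R <;> rfl

theorem c1_ext {f g : Ser} (h : ∀ k, c1 k f = c1 k g) : f = g := by
  refine HahnSeries.ext (funext fun i => ?_)
  have := h (-i)
  simpa [c1] using this

theorem c2_ext (R : Region) {f g : Dbl} (h : ∀ k l, c2 R k l f = c2 R k l g) : f = g := by
  refine HahnSeries.ext (funext fun i => HahnSeries.ext (funext fun j => ?_))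
  cases R
  · have := h (-i) (-j)
    simpa [c2] using this
  · have := h (-j) (-i)
    simpa [c2] using this

/-- `f ↦ f(ζ₁)`. -/
noncomputable def at1Hom (R : Region) : Ser →+* Dbl :=
  match R with
  | .I => scale (HahnSeries.C : ℂ →+* HahnSeries ℤ ℂ) 1
  | .II => (HahnSeries.C : HahnSeries ℤ ℂ →+* HahnSeries ℤ (HahnSeries ℤ ℂ))

/-- `f ↦ f(ζ₂)`. -/
noncomputable def at2Hom (R : Region) : Ser →+* Dbl :=
  match R with
  | .I => (HahnSeries.C : HahnSeries ℤ ℂ →+* HahnSeries ℤ (HahnSeries ℤ ℂ))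
  | .II => scale (HahnSeries.C : ℂ →+* HahnSeries ℤ ℂ) 1

theorem outer_eq_scale (f : Series) :
    outer f = scale (HahnSeries.C : ℂ →+* HahnSeries ℤ ℂ) 1 f := by
  refine HahnSeries.ext (funext fun i => ?_)
  rw [coeff_scale, one_zpow, Units.val_one, one_mul]
  rfl

theorem at1_eq_hom (R : Region) (f : Ser) : toDbl (at1 R f) = at1Hom R f := by
  cases R
  · exact outer_eq_scale f
  · rfl

theorem at2_eq_hom (R : Region) (f : Ser) : toDbl (at2 R f) = at2Hom R f := by
  cases R
  · rfl
  · exact outer_eq_scale f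

theorem c1_mul_ne_zero {k : ℤ} {f g : Ser} (h : c1 k (f * g) ≠ 0) :
    ∃ k₁ k₂, k₁ + k₂ = k ∧ c1 k₁ f ≠ 0 ∧ c1 k₂ g ≠ 0 := by
  obtain ⟨i, j, hij, h⟩ := exists_of_coeff_mul_ne_zero (A := ℂ) (B := ℂ) (f := f) (g := g) (k := -k)
    (AddMonoidHom.id ℂ) h
  refine ⟨-i, -j, by omega, ?_, ?_⟩
  · have := left_ne_zero_of_mul h
    simpa [c1] using this
  · have := right_ne_zero_of_mul h
    simpa [c1] using this

theorem double_coeff_mul_ne_zero {i j : ℤ} {f g : HahnSeries ℤ (HahnSeries ℤ ℂ)}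
    (h : ((f * g).coeff i).coeff j ≠ 0) :
    ∃ i₁ i₂ j₁ j₂, i₁ + i₂ = i ∧ j₁ + j₂ = j ∧ (f.coeff i₁).coeff j₁ ≠ 0 ∧
      (g.coeff i₂).coeff j₂ ≠ 0 := by
  obtain ⟨i₁, i₂, hi, h⟩ := exists_of_coeff_mul_ne_zero (f := f) (g := g) (k := i)
    (⟨⟨fun x => x.coeff j, rfl⟩, fun _ _ => rfl⟩ : HahnSeries ℤ ℂ →+ ℂ) h
  obtain ⟨j₁, j₂, hj, h⟩ := exists_of_coeff_mul_ne_zero (f := f.coeff i₁) (g := g.coeff i₂)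
    (B := ℂ) (k := j) (AddMonoidHom.id ℂ) h
  exact ⟨i₁, i₂, j₁, j₂, hi, hj, left_ne_zero_of_mul h, right_ne_zero_of_mul h⟩

theorem c2_mul_ne_zero {R : Region} {k l : ℤ} {f g : Dbl} (h : c2 R k l (f * g) ≠ 0) :
    ∃ k₁ k₂ l₁ l₂, k₁ + k₂ = k ∧ l₁ + l₂ = l ∧ c2 R k₁ l₁ f ≠ 0 ∧ c2 R k₂ l₂ g ≠ 0 := by
  cases R
  · obtain ⟨i₁, i₂, j₁, j₂, hi, hj, h1, h2⟩ := double_coeff_mul_ne_zero (f := f) (g := g) h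
    refine ⟨-i₁, -i₂, -j₁, -j₂, by omega, by omega, ?_, ?_⟩
    · simpa [c2] using h1
    · simpa [c2] using h2
  · obtain ⟨i₁, i₂, j₁, j₂, hi, hj, h1, h2⟩ := double_coeff_mul_ne_zero (f := f) (g := g) h
    refine ⟨-j₁, -j₂, -i₁, -i₂, by omega, by omega, ?_, ?_⟩
    · simpa [c2] using h1
    · simpa [c2] using h2

theorem scale_C_coeff (f : HahnSeries ℤ ℂ) (i j : ℤ) :
    ((scale (HahnSeries.C : ℂ →+* HahnSeries ℤ ℂ) 1 f).coeff i).coeff j =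
      if j = 0 then f.coeff i else 0 := by
  rw [coeff_scale, one_zpow, Units.val_one, one_mul, HahnSeries.C_apply, HahnSeries.coeff_single]
  split_ifs <;> rfl

theorem C_coeff_coeff (f : HahnSeries ℤ ℂ) (i j : ℤ) :
    ((HahnSeries.C f : HahnSeries ℤ (HahnSeries ℤ ℂ)).coeff i).coeff j =
      if i = 0 then f.coeff j else 0 := by
  rw [HahnSeries.C_apply, HahnSeries.coeff_single]
  split_ifs <;> rfl

theorem c2_at1 (R : Region) (k l : ℤ) (f : Ser) :
    c2 R k l (at1Hom R f) = if l = 0 then c1 k f else 0 := by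
  cases R
  · exact (scale_C_coeff f (-k) (-l)).trans (if_congr neg_eq_zero rfl rfl)
  · exact (C_coeff_coeff f (-l) (-k)).trans (if_congr neg_eq_zero rfl rfl)

theorem c2_at2 (R : Region) (k l : ℤ) (f : Ser) :
    c2 R k l (at2Hom R f) = if k = 0 then c1 l f else 0 := by
  cases R
  · exact c2_at1 .II l k f
  · exact c2_at1 .I l k f

/-! ### Monomials and constants -/

/-- The series `lam ^ k`. -/
noncomputable def lam (k : ℤ) : Ser := toSer (lamPow k)

/-- The constants. -/
noncomputable def cst : ℂ →+* Ser := (HahnSeries.C : ℂ →+* HahnSeries ℤ ℂ)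

theorem scale_C_single (n : ℤ) (c : ℂ) :
    scale (HahnSeries.C : ℂ →+* HahnSeries ℤ ℂ) 1 (HahnSeries.single n c) =
      HahnSeries.single n (HahnSeries.C c) := by
  refine HahnSeries.ext (funext fun i => ?_)
  rw [coeff_scale, one_zpow, Units.val_one, one_mul, HahnSeries.coeff_single,
    HahnSeries.coeff_single]
  split_ifs <;> simp

theorem scale_C_single_mul_coeff (n i j : ℤ) (c : ℂ) (f : HahnSeries ℤ (HahnSeries ℤ ℂ)) :
    ((scale (HahnSeries.C : ℂ →+* HahnSeries ℤ ℂ) 1 (HahnSeries.single n c) * f).coeff i).coeff j =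
      c * (f.coeff (i - n)).coeff j := by
  rw [scale_C_single, HahnSeries.coeff_single_mul, HahnSeries.C_apply,
    HahnSeries.coeff_single_zero_mul]

theorem C_single_mul_coeff (n i j : ℤ) (c : ℂ) (f : HahnSeries ℤ (HahnSeries ℤ ℂ)) :
    ((HahnSeries.C (HahnSeries.single n c) * f).coeff i).coeff j =
      c * (f.coeff i).coeff (j - n) := by
  rw [HahnSeries.C_apply, HahnSeries.coeff_single_zero_mul, HahnSeries.coeff_single_mul]

theorem c2_at1_single_mul (R : Region) (k l n : ℤ) (c : ℂ) (f : Dbl) :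
    c2 R k l (at1Hom R (HahnSeries.single (-n) c : HahnSeries ℤ ℂ) * f) =
      c * c2 R (k - n) l f := by
  have e : -k - -n = -(k - n) := by ring
  cases R
  · have := scale_C_single_mul_coeff (-n) (-k) (-l) c f
    rw [e] at this
    exact this
  · have := C_single_mul_coeff (-n) (-l) (-k) c f
    rw [e] at this
    exact this

theorem c2_at2_single_mul (R : Region) (k l n : ℤ) (c : ℂ) (f : Dbl) :
    c2 R k l (at2Hom R (HahnSeries.single (-n) c : HahnSeries ℤ ℂ) * f) =
      c * c2 R k (l - n) f := by
  cases R
  · exact c2_at1_single_mul .II l k n c f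
  · exact c2_at1_single_mul .I l k n c f

theorem c2_at1_lam_mul (R : Region) (k l n : ℤ) (f : Dbl) :
    c2 R k l (at1Hom R (lam n) * f) = c2 R (k - n) l f :=
  (c2_at1_single_mul R k l n 1 f).trans (one_mul _)

theorem c2_at2_lam_mul (R : Region) (k l n : ℤ) (f : Dbl) :
    c2 R k l (at2Hom R (lam n) * f) = c2 R k (l - n) f :=
  (c2_at2_single_mul R k l n 1 f).trans (one_mul _)

theorem c2_cst_mul (R : Region) (k l : ℤ) (c : ℂ) (f : Dbl) :
    c2 R k l (at1Hom R (cst c) * f) = c * c2 R k l f := by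
  have := c2_at1_single_mul R k l 0 c f
  rwa [sub_zero, neg_zero] at this

theorem c1_cst_mul_lam (k n : ℤ) (c : ℂ) : c1 k (cst c * lam n) = if k = n then c else 0 := by
  change (HahnSeries.single (0 : ℤ) c * HahnSeries.single (-n) (1 : ℂ)).coeff (-k) = _
  rw [HahnSeries.single_mul_single, zero_add, mul_one, HahnSeries.coeff_single]
  simp only [neg_inj]

theorem c1_lam_mul (k n : ℤ) (f : Ser) : c1 k (lam n * f) = c1 (k - n) f := by
  have := HahnSeries.coeff_single_mul (r := (1 : ℂ)) (x := f) (a := -k) (b := -n)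
  rw [one_mul, show -k - -n = -(k - n) by ring] at this
  exact this

theorem c1_cst_mul (k : ℤ) (c : ℂ) (f : Ser) : c1 k (cst c * f) = c * c1 k f :=
  HahnSeries.coeff_single_zero_mul (r := c) (x := f) (a := -k)

theorem c1_one (k : ℤ) : c1 k 1 = if k = 0 then 1 else 0 := by
  change (1 : HahnSeries ℤ ℂ).coeff (-k) = _
  rw [HahnSeries.coeff_one]
  simp only [neg_eq_zero]

theorem c2_one (R : Region) (k l : ℤ) : c2 R k l 1 = if k = 0 ∧ l = 0 then 1 else 0 := by
  rw [← map_one (at1Hom R), c2_at1, c1_one]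
  split_ifs <;> simp_all

theorem lam_add (m n : ℤ) : lam (m + n) = lam m * lam n :=
  c1_ext fun k => by
    rw [c1_lam_mul]
    have h1 := c1_cst_mul_lam k (m + n) 1
    have h2 := c1_cst_mul_lam (k - m) n 1
    rw [map_one, one_mul] at h1 h2
    rw [h1, h2]
    exact if_congr (by omega) rfl rfl

theorem lam_zero : lam 0 = 1 := rfl

theorem lam_pow (m : ℤ) (n : ℕ) : lam m ^ n = lam (m * n) := by
  induction n with
  | zero => simp [lam_zero]
  | succ n ih => rw [pow_succ, ih, ← lam_add]; congr 1; push_cast; ring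

theorem lam_neg_mul (m : ℤ) : lam (-m) * lam m = 1 := by
  rw [← lam_add, neg_add_cancel, lam_zero]

theorem lam_inv (m : ℤ) : (lam m)⁻¹ = lam (-m) :=
  (eq_inv_of_mul_eq_one_left (lam_neg_mul m)).symm

theorem at1_cst_eq_at2_cst (R : Region) (c : ℂ) : at1Hom R (cst c) = at2Hom R (cst c) :=
  c2_ext R fun k l => by
    rw [← mul_one (at1Hom R (cst c)), ← mul_one (at2Hom R (cst c)), c2_cst_mul]
    have := c2_at2_single_mul R k l 0 c 1
    rw [sub_zero, neg_zero] at this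
    exact this.symm

/-! ### Rotations of the variables -/

/-- The substitution `lam ↦ u lam`. -/
noncomputable def tw1 (u : ℂˣ) : Ser →+* Ser := scale (RingHom.id ℂ) u

theorem c1_tw1 (u : ℂˣ) (k : ℤ) (f : Ser) : c1 k (tw1 u f) = ↑(u ^ k) * c1 k f := by
  have := coeff_scale (RingHom.id ℂ) u f (-k)
  rw [neg_neg] at this
  exact this

theorem scale_scale_coeff (u v : ℂˣ) (f : HahnSeries ℤ (HahnSeries ℤ ℂ)) (k l : ℤ) :
    ((scale (scale (RingHom.id ℂ) v)
      (Units.map (HahnSeries.C : ℂ →+* HahnSeries ℤ ℂ).toMonoidHom u) f).coeff (-k)).coeff (-l) =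
      ↑(u ^ k) * ↑(v ^ l) * (f.coeff (-k)).coeff (-l) := by
  rw [coeff_scale, ← map_zpow, neg_neg]
  have : ((Units.map (HahnSeries.C : ℂ →+* HahnSeries ℤ ℂ).toMonoidHom (u ^ k) : _) :
      HahnSeries ℤ ℂ) = HahnSeries.single 0 ((u ^ k : ℂˣ) : ℂ) := rfl
  rw [this, HahnSeries.coeff_single_zero_mul, coeff_scale, neg_neg, mul_assoc]
  rfl

/-- The substitution `lam₁ ↦ u lam₁`, `lam₂ ↦ v lam₂`. -/
noncomputable def tw2 (R : Region) (u v : ℂˣ) : Dbl →+* Dbl :=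
  match R with
  | .I => scale (scale (RingHom.id ℂ) v)
      (Units.map (HahnSeries.C : ℂ →+* HahnSeries ℤ ℂ).toMonoidHom u)
  | .II => scale (scale (RingHom.id ℂ) u)
      (Units.map (HahnSeries.C : ℂ →+* HahnSeries ℤ ℂ).toMonoidHom v)

theorem c2_tw2 (R : Region) (u v : ℂˣ) (k l : ℤ) (f : Dbl) :
    c2 R k l (tw2 R u v f) = ↑(u ^ k) * ↑(v ^ l) * c2 R k l f := by
  cases R
  · exact scale_scale_coeff u v f k l
  · exact (scale_scale_coeff v u f l k).trans
      (congrArg (· * c2 .II k l f) (mul_comm ((v ^ l : ℂˣ) : ℂ) ((u ^ k : ℂˣ) : ℂ)))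

theorem tw2_at1 (R : Region) (u v : ℂˣ) (f : Ser) :
    tw2 R u v (at1Hom R f) = at1Hom R (tw1 u f) :=
  c2_ext R fun k l => by
    rw [c2_tw2, c2_at1, c2_at1, c1_tw1]
    split_ifs with h
    · simp [h]
    · simp

theorem tw2_at2 (R : Region) (u v : ℂˣ) (f : Ser) :
    tw2 R u v (at2Hom R f) = at2Hom R (tw1 v f) :=
  c2_ext R fun k l => by
    rw [c2_tw2, c2_at2, c2_at2, c1_tw1]
    split_ifs with h
    · simp [h]
    · simp

theorem tw1_lam (u : ℂˣ) (n : ℤ) : tw1 u (lam n) = cst ↑(u ^ n) * lam n :=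
  c1_ext fun k => by
    have h := c1_cst_mul_lam k n 1
    rw [map_one, one_mul] at h
    rw [c1_tw1, c1_cst_mul, h]
    split_ifs with e
    · rw [e]
    · simp

theorem tw1_cst (u : ℂˣ) (c : ℂ) : tw1 u (cst c) = cst c :=
  c1_ext fun k => by
    rw [c1_tw1, ← mul_one (cst c), c1_cst_mul, c1_one]
    split_ifs with e
    · simp [e]
    · simp

theorem c2_twoVar (R : Region) (c : ℕ → ℕ → ℂ) (k l : ℤ) :
    c2 R k l (toDbl (twoVar R c)) = if k ≤ 0 ∧ l ≤ 0 then c (-k).toNat (-l).toNat else 0 := by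
  have key : ∀ (d : ℕ → ℕ → ℂ) (i j : ℤ),
      ((HahnSeries.ofPowerSeries ℤ (HahnSeries ℤ ℂ) (PowerSeries.mk fun i =>
        HahnSeries.ofPowerSeries ℤ ℂ (PowerSeries.mk fun j => d i j))).coeff i).coeff j =
      if 0 ≤ i then if 0 ≤ j then d i.toNat j.toNat else 0 else 0 := by
    intro d i j
    rw [coeff_ofPowerSeries_mk]
    split_ifs with h h'
    · rw [coeff_ofPowerSeries_mk, if_pos h']
    · rw [coeff_ofPowerSeries_mk, if_neg h']
    · rfl
  cases R
  · refine (key c (-k) (-l)).trans ?_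
    simp only [Left.nonneg_neg_iff]
    split_ifs <;> first | rfl | omega
  · refine (key (fun i j => c j i) (-l) (-k)).trans ?_
    simp only [Left.nonneg_neg_iff]
    split_ifs <;> first | rfl | omega

/-! ### Expansions that agree in both regions -/

theorem c1_bounded (f : Ser) : ∃ K : ℤ, ∀ k, c1 k f ≠ 0 → k ≤ K := by
  refine ⟨-(HahnSeries.order (f : HahnSeries ℤ ℂ)), fun k hk => ?_⟩
  have := HahnSeries.order_le_of_coeff_ne_zero (x := (f : HahnSeries ℤ ℂ)) hk
  omega

theorem double_coeff_mul_eq_sum {f g : HahnSeries ℤ (HahnSeries ℤ ℂ)} {K : ℤ}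
    (hf : ∀ i j, (f.coeff i).coeff j ≠ 0 → -K ≤ i ∧ -K ≤ j)
    (hg : ∀ i j, (g.coeff i).coeff j ≠ 0 → -K ≤ i ∧ -K ≤ j) (i j : ℤ) :
    ((f * g).coeff i).coeff j = ∑ a ∈ Finset.Icc (-K) (i + K), ∑ b ∈ Finset.Icc (-K) (j + K),
      (f.coeff a).coeff b * (g.coeff (i - a)).coeff (j - b) := by
  have outer_bound : ∀ h : HahnSeries ℤ (HahnSeries ℤ ℂ),
      (∀ i j, (h.coeff i).coeff j ≠ 0 → -K ≤ i ∧ -K ≤ j) → ∀ i, h.coeff i ≠ 0 → -K ≤ i := by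
    intro h hh i hi
    by_contra hlt
    refine hi (HahnSeries.ext (funext fun j => ?_))
    by_contra hj
    exact hlt (hh i j hj).1
  rw [coeff_mul_of_lower_bound (outer_bound f hf) (outer_bound g hg)]
  have hsum : ∀ (s : Finset ℤ) (F : ℤ → HahnSeries ℤ ℂ),
      (∑ a ∈ s, F a).coeff j = ∑ a ∈ s, (F a).coeff j := fun s F =>
    map_sum (⟨⟨fun x => x.coeff j, rfl⟩, fun _ _ => rfl⟩ : HahnSeries ℤ ℂ →+ ℂ) F s
  rw [hsum]
  refine Finset.sum_congr rfl fun a _ => ?_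
  exact coeff_mul_of_lower_bound (fun b h => (hf a b h).2) (fun b h => (hg (i - a) b h).2) j

/-- On the right the region enters only through the coefficients of the factors. If these agree in
both regions, so do those of the product, which makes `Reg` a ring. -/
theorem c2_mul_eq_sum {R : Region} {f g : Dbl} {K : ℤ}
    (hf : ∀ k l, c2 R k l f ≠ 0 → k ≤ K ∧ l ≤ K) (hg : ∀ k l, c2 R k l g ≠ 0 → k ≤ K ∧ l ≤ K)
    (k l : ℤ) :
    c2 R k l (f * g) = ∑ a ∈ Finset.Icc (-K) (-k + K), ∑ b ∈ Finset.Icc (-K) (-l + K),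
      c2 R (-a) (-b) f * c2 R (k + a) (l + b) g := by
  cases R
  · refine (double_coeff_mul_eq_sum (f := f) (g := g) (K := K) ?_ ?_ (-k) (-l)).trans ?_
    · intro i j h
      have := hf (-i) (-j) (by simpa [c2] using h)
      omega
    · intro i j h
      have := hg (-i) (-j) (by simpa [c2] using h)
      omega
    · refine Finset.sum_congr rfl fun a _ => Finset.sum_congr rfl fun b _ => ?_
      simp only [c2, AddMonoidHom.coe_mk, ZeroHom.coe_mk, neg_neg, neg_add]
      rfl
  · refine (double_coeff_mul_eq_sum (f := f) (g := g) (K := K) ?_ ?_ (-l) (-k)).trans ?_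
    · intro i j h
      have := hf (-j) (-i) (by simpa [c2] using h)
      omega
    · intro i j h
      have := hg (-j) (-i) (by simpa [c2] using h)
      omega
    -- In region II the outer variable is λ₂, so the two sums come out in the opposite order.
    · rw [Finset.sum_comm]
      refine Finset.sum_congr rfl fun a _ => Finset.sum_congr rfl fun b _ => ?_
      simp only [c2, AddMonoidHom.coe_mk, ZeroHom.coe_mk, neg_neg, neg_add]
      rfl

/-- Pairs of expansions with exponents bounded above in both variables and with the same
coefficients in both regions. -/
noncomputable def Reg : Subring (Region → Dbl) where
  carrier := {f | (∀ k l, c2 .I k l (f .I) = c2 .II k l (f .II)) ∧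
    ∃ K : ℤ, ∀ R k l, c2 R k l (f R) ≠ 0 → k ≤ K ∧ l ≤ K}
  zero_mem' := ⟨fun k l => by simp, 0, fun R k l h => by simp at h⟩
  one_mem' := by
    refine ⟨fun k l => by simp only [Pi.one_apply, c2_one], 0, fun R k l h => ?_⟩
    rw [Pi.one_apply, c2_one] at h
    have := (ite_ne_right_iff.1 h).1
    omega
  neg_mem' := by
    rintro f ⟨h1, K, h2⟩
    refine ⟨fun k l => by simp only [Pi.neg_apply, map_neg, h1], K, fun R k l h => h2 R k l ?_⟩
    rwa [Pi.neg_apply, map_neg, neg_ne_zero] at h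
  add_mem' := by
    rintro f g ⟨h1, K, h2⟩ ⟨h3, L, h4⟩
    refine ⟨fun k l => by simp only [Pi.add_apply, map_add, h1, h3], max K L, fun R k l h => ?_⟩
    rw [Pi.add_apply, map_add] at h
    by_cases h5 : c2 R k l (f R) = 0
    · rw [h5, zero_add] at h
      have := h4 R k l h
      omega
    · have := h2 R k l h5
      omega
  mul_mem' := by
    rintro f g ⟨h1, K, h2⟩ ⟨h3, L, h4⟩
    refine ⟨fun k l => ?_, K + L, fun R k l h => ?_⟩
    · have b1 : ∀ R k l, c2 R k l (f R) ≠ 0 → k ≤ max K L ∧ l ≤ max K L := fun R k l h => by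
        have := h2 R k l h
        omega
      have b2 : ∀ R k l, c2 R k l (g R) ≠ 0 → k ≤ max K L ∧ l ≤ max K L := fun R k l h => by
        have := h4 R k l h
        omega
      rw [Pi.mul_apply, Pi.mul_apply, c2_mul_eq_sum (b1 _) (b2 _), c2_mul_eq_sum (b1 _) (b2 _)]
      simp only [h1, h3]
    · rw [Pi.mul_apply] at h
      obtain ⟨k₁, k₂, l₁, l₂, hk, hl, h5, h6⟩ := c2_mul_ne_zero h
      have := h2 R _ _ h5
      have := h4 R _ _ h6
      omega

theorem Reg.coeff_eq {f : Region → Dbl} (hf : f ∈ Reg) (R R' : Region) (k l : ℤ) :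
    c2 R k l (f R) = c2 R' k l (f R') := by
  cases R <;> cases R'
  · rfl
  · exact hf.1 k l
  · exact (hf.1 k l).symm
  · rfl

theorem at1_mem_reg (f : Ser) : (fun R => at1Hom R f) ∈ Reg := by
  obtain ⟨K, hK⟩ := c1_bounded f
  refine ⟨fun k l => by rw [c2_at1, c2_at1], max K 0, fun R k l h => ?_⟩
  rw [c2_at1] at h
  obtain ⟨h1, h2⟩ := ite_ne_right_iff.1 h
  have := hK k h2
  omega

theorem at2_mem_reg (f : Ser) : (fun R => at2Hom R f) ∈ Reg := by
  obtain ⟨K, hK⟩ := c1_bounded f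
  refine ⟨fun k l => by rw [c2_at2, c2_at2], max K 0, fun R k l h => ?_⟩
  rw [c2_at2] at h
  obtain ⟨h1, h2⟩ := ite_ne_right_iff.1 h
  have := hK l h2
  omega

theorem twoVar_mem_reg (c : ℕ → ℕ → ℂ) : (fun R => toDbl (twoVar R c)) ∈ Reg := by
  refine ⟨fun k l => by rw [c2_twoVar, c2_twoVar], 0, fun R k l h => ?_⟩
  rw [c2_twoVar] at h
  exact (ite_ne_right_iff.1 h).1

/-! ### Recognising polynomials in ζ₁ and ζ₂ -/

/-- Evaluation of polynomials at `(ζ₁, ζ₂)`. -/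
noncomputable def evalHom (R : Region) (p : ℕ) : MvPolynomial (Fin 2) ℂ →+* Dbl :=
  MvPolynomial.eval₂Hom ((at1Hom R).comp cst) ![at1Hom R (lam p), at2Hom R (lam p)]

theorem at1_cst (R : Region) (c : ℂ) : at1Hom R (cst c) = toDbl (const2 c) := by
  cases R
  · exact scale_C_single 0 c
  · rfl

theorem evalZeta_eq (R : Region) (p : ℕ) (B : MvPolynomial (Fin 2) ℂ) :
    toDbl (evalZeta R p B) = evalHom R p B := by
  have h : (at1Hom R).comp cst =
      ((HahnSeries.C : LaurentSeries ℂ →+* Double).comp HahnSeries.C : ℂ →+* Double) :=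
    RingHom.ext fun c => at1_cst R c
  have h2 : ![at1Hom R (lam p), at2Hom R (lam p)] =
      ![toDbl (zeta1 R p), toDbl (zeta2 R p)] := by
    rw [zeta1, zeta2, ← at1_eq_hom R (lam p), ← at2_eq_hom R (lam p)]
    rfl
  rw [evalHom, h, h2]
  rfl

theorem c2_monomial (R : Region) (k l m n : ℤ) (c : ℂ) :
    c2 R k l (at1Hom R (cst c) * (at1Hom R (lam m) * at2Hom R (lam n))) =
      if k = m ∧ l = n then c else 0 := by
  rw [c2_cst_mul, c2_at1_lam_mul, ← mul_one (at2Hom R (lam n)), c2_at2_lam_mul, c2_one]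
  simp only [sub_eq_zero]
  split_ifs <;> simp

/-- An upper bound on the exponents together with non-negativity leaves finitely many monomials, and
membership in `Reg` lets the coefficients found in region I serve in both. -/
theorem exists_polynomial {p : ℕ} (hp : 0 < p) {f : Region → Dbl} (hf : f ∈ Reg)
    (hs : ∀ R k l, c2 R k l (f R) ≠ 0 → ∃ M N : ℕ, k = (p : ℤ) * M ∧ l = (p : ℤ) * N) :
    ∃ B : MvPolynomial (Fin 2) ℂ, ∀ R, evalHom R p B = f R := by
  obtain ⟨K, hK⟩ := hf.2
  -- Since p ≥ 1, an occurring exponent p M satisfies M ≤ p M ≤ K, hence M < L.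
  let L := K.toNat + 1
  refine ⟨∑ M ∈ Finset.range L, ∑ N ∈ Finset.range L,
    MvPolynomial.C (c2 .I ((p : ℤ) * M) ((p : ℤ) * N) (f .I)) *
      (MvPolynomial.X 0 ^ M * MvPolynomial.X 1 ^ N), fun R => c2_ext R fun k l => ?_⟩
  simp only [map_sum, map_mul, map_pow]
  have h1 : ∀ M N : ℕ, ∀ c, c2 R k l (evalHom R p (MvPolynomial.C c) *
      (evalHom R p (MvPolynomial.X 0) ^ M * evalHom R p (MvPolynomial.X 1) ^ N)) =
      if k = (p : ℤ) * M ∧ l = (p : ℤ) * N then c else 0 := by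
    intro M N c
    simp only [evalHom, MvPolynomial.coe_eval₂Hom, MvPolynomial.eval₂_C, MvPolynomial.eval₂_X]
    simp only [RingHom.comp_apply, Matrix.cons_val_zero, Matrix.cons_val_one, ← map_pow, lam_pow]
    exact c2_monomial R k l _ _ c
  simp only [h1]
  by_cases h0 : c2 R k l (f R) = 0
  · rw [h0]
    refine Finset.sum_eq_zero fun M _ => Finset.sum_eq_zero fun N _ => ?_
    split_ifs with h
    · rw [← h.1, ← h.2, Reg.coeff_eq hf .I R, h0]
    · rfl
  · obtain ⟨M, N, rfl, rfl⟩ := hs R k l h0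
    obtain ⟨hM, hN⟩ := hK R _ _ h0
    have hp' : (1 : ℤ) ≤ p := by exact_mod_cast hp
    have hM' : M < L := by
      have : (M : ℤ) ≤ p * M := by nlinarith
      omega
    have hN' : N < L := by
      have : (N : ℤ) ≤ p * N := by nlinarith
      omega
    have hpz : (p : ℤ) ≠ 0 := by omega
    rw [Finset.sum_eq_single M, Finset.sum_eq_single N, if_pos ⟨rfl, rfl⟩, Reg.coeff_eq hf .I R]
    · intro N' _ hne
      refine if_neg fun h => hne ?_
      have := mul_left_cancel₀ hpz h.2
      omega
    · exact fun h => absurd (Finset.mem_range.2 hN') h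
    · intro M' _ hne
      refine Finset.sum_eq_zero fun N' _ => if_neg fun h => hne ?_
      have := mul_left_cancel₀ hpz h.1
      omega
    · exact fun h => absurd (Finset.mem_range.2 hM') h

/-! ### Roots of unity and the sheets of the disk amplitude -/

/-- `ω` as a unit. -/
noncomputable def om (p : ℕ) : ℂˣ := Units.mk0 (omega p) (Complex.exp_ne_zero _)

theorem om_primitive {p : ℕ} (hp : 0 < p) : IsPrimitiveRoot (om p) p :=
  IsPrimitiveRoot.coe_units_iff.1 (Complex.isPrimitiveRoot_exp p hp.ne')

/-- The term with index m carries λ^(m-p) because of the factor ζ⁻¹; this shift by p is invisible to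
ω. -/
theorem om_pow_zpow {p : ℕ} (hp : 0 < p) (a : ℕ) {k m : ℤ} (h : k = m - p) :
    (om p ^ a) ^ k = om p ^ (m * a) := by
  rw [← zpow_natCast, ← zpow_mul, h, show (a : ℤ) * (m - p) = m * a + p * (-a) by ring, zpow_add,
    zpow_mul, zpow_mul (om p) p, zpow_natCast (om p) p, (om_primitive hp).pow_eq_one, one_zpow,
    mul_one]

/-- A geometric sum with ratio ω^k, whose p-th power is 1; the ratio itself is 1 only when p divides
k. -/
theorem sum_om_pow {p : ℕ} (hp : 0 < p) (k : ℤ) :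
    ∑ a ∈ Finset.range p, (((om p ^ a) ^ k : ℂˣ) : ℂ) = if (p : ℤ) ∣ k then (p : ℂ) else 0 := by
  have h1 : ∀ a : ℕ, (((om p ^ a) ^ k : ℂˣ) : ℂ) = (((om p ^ k : ℂˣ) : ℂ)) ^ a := fun a => by
    rw [← Units.val_pow_eq_pow_val, ← zpow_natCast, ← zpow_natCast, ← zpow_mul, ← zpow_mul,
      mul_comm]
  simp only [h1]
  have h2 := (om_primitive hp).zpow_eq_one_iff_dvd k
  split_ifs with h
  · simp [h2.2 h]
  · have h3 : ((om p ^ k : ℂˣ) : ℂ) - 1 ≠ 0 := fun e =>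
      h (h2.1 (Units.ext (sub_eq_zero.1 e)))
    refine (mul_eq_zero.1 ?_).resolve_left h3
    rw [mul_geom_sum, ← Units.val_pow_eq_pow_val, ← zpow_natCast, ← zpow_mul, mul_comm, zpow_mul,
      zpow_natCast, (om_primitive hp).pow_eq_one, one_zpow, Units.val_one, sub_self]

theorem diskQ_eq (p q : ℕ) (b v : ℕ → ℂ) (a : ℕ) :
    toSer (diskQ p q b v a) = cst (p : ℂ)⁻¹ *
      (∑ n ∈ Finset.Icc 1 (p + q), cst ((n : ℂ) * b n * omega p ^ (n * a)) * lam ((n : ℤ) - p) +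
        lam (-(p : ℤ)) * toSer (HahnSeries.ofPowerSeries ℤ ℂ (PowerSeries.mk fun n =>
          if n = 0 then 0 else v n * (omega p)⁻¹ ^ (n * a)))) := rfl

theorem c1_ofPowerSeries_mk (c : ℕ → ℂ) (k : ℤ) :
    c1 k (toSer (HahnSeries.ofPowerSeries ℤ ℂ (PowerSeries.mk c))) =
      if k ≤ 0 then c (-k).toNat else 0 := by
  refine (coeff_ofPowerSeries_mk c (-k)).trans ?_
  simp only [Left.nonneg_neg_iff]

theorem c1_diskQ (p q : ℕ) (b v : ℕ → ℂ) (a : ℕ) (k : ℤ) :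
    c1 k (toSer (diskQ p q b v a)) = (p : ℂ)⁻¹ *
      (∑ n ∈ Finset.Icc 1 (p + q),
          (if k = (n : ℤ) - p then (n : ℂ) * b n * omega p ^ (n * a) else 0) +
        if k + p ≤ 0 then
          if (-(k + p)).toNat = 0 then 0
          else v (-(k + p)).toNat * (omega p)⁻¹ ^ ((-(k + p)).toNat * a)
        else 0) := by
  rw [diskQ_eq, c1_cst_mul, map_add, map_sum, c1_lam_mul, c1_ofPowerSeries_mk, sub_neg_eq_add]
  simp only [c1_cst_mul_lam]

theorem diskQ_eq_tw1 {p : ℕ} (hp : 0 < p) (q : ℕ) (b v : ℕ → ℂ) (a : ℕ) :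
    toSer (diskQ p q b v a) = tw1 (om p ^ a) (toSer (diskQ p q b v 0)) := by
  refine c1_ext fun k => ?_
  rw [c1_tw1, c1_diskQ, c1_diskQ, mul_left_comm]
  congr 1
  rw [mul_add, Finset.mul_sum]
  congr 1
  · refine Finset.sum_congr rfl fun n _ => ?_
    split_ifs with h
    · rw [om_pow_zpow hp a h, mul_zero, pow_zero, mul_one, mul_comm]
      congr 1
    · simp
  · split_ifs with h h'
    · simp
    · rw [om_pow_zpow hp a (m := k + p) (by ring), mul_zero, pow_zero, mul_one, mul_comm]
      congr 1
      obtain ⟨n, hn⟩ : ∃ n : ℕ, -(k + p) = n := ⟨(-(k + p)).toNat, by omega⟩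
      rw [hn, Int.toNat_natCast, show k + p = -(n : ℤ) by omega,
        show -(n : ℤ) * a = -((n * a : ℕ) : ℤ) by push_cast; ring, zpow_neg, zpow_natCast,
        ← inv_pow, Units.val_pow_eq_pow_val, Units.val_inv_eq_inv_val]
      rfl
    · simp

/-- Compare the coefficients of λ^q: only the term n = p + q contributes, it is nonzero, and
rotation multiplies it by ω^(aq). As q is prime to p, ω^q is again a primitive p-th root of unity.
-/
theorem diskQ_distinct {p q : ℕ} (hp : 0 < p) (hpq : Nat.Coprime p q) {b : ℕ → ℂ}
    (hb : b (p + q) ≠ 0) (v : ℕ → ℂ) : Distinct p (diskQ p q b v) := by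
  intro a ha a' ha' h
  have h0 : c1 q (toSer (diskQ p q b v 0)) ≠ 0 := by
    rw [c1_diskQ, if_neg (by omega), add_zero, Finset.sum_eq_single (p + q), if_pos (by simp)]
    · have : ((p + q : ℕ) : ℂ) ≠ 0 := Nat.cast_ne_zero.2 (by omega)
      have : (p : ℂ) ≠ 0 := Nat.cast_ne_zero.2 (by omega)
      simp_all
    · intro n _ hn
      exact if_neg fun h => hn (by omega)
    · intro hn
      exact absurd (Finset.mem_Icc.2 ⟨by omega, le_rfl⟩) hn
  have h1 : c1 q (toSer (diskQ p q b v a)) = c1 q (toSer (diskQ p q b v a')) := by rw [h]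
  rw [diskQ_eq_tw1 hp, diskQ_eq_tw1 hp q b v a', c1_tw1, c1_tw1] at h1
  have h2 := Units.ext (mul_right_cancel₀ h0 h1)
  rw [zpow_natCast, zpow_natCast, ← pow_mul, ← pow_mul, mul_comm, mul_comm a', pow_mul,
    pow_mul] at h2
  exact ((om_primitive hp).pow_of_coprime q hpq.symm).pow_inj ha ha' h2

/-! ### The annulus amplitudes as rotations of sheet (0, 0) -/

theorem zeta1_eq (R : Region) (p : ℕ) : toDbl (zeta1 R p) = at1Hom R (lam p) := at1_eq_hom R (lam p)

theorem zeta2_eq (R : Region) (p : ℕ) : toDbl (zeta2 R p) = at2Hom R (lam p) := at2_eq_hom R (lam p)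

/-- The numerators of the universal part, as coefficients of `lam₁ ^ (-n) lam₂ ^ (-m)`. -/
noncomputable def univCoeff (p : ℕ) (w : ℕ → ℕ → ℂ) (a b n m : ℕ) : ℂ :=
  if n = 0 ∨ m = 0 then 0 else w n m * (omega p)⁻¹ ^ (n * a) * (omega p)⁻¹ ^ (m * b)

theorem universalPart_eq (R : Region) (p : ℕ) (w : ℕ → ℕ → ℂ) (a b : ℕ) :
    toDbl (universalPart R p w a b) =
      ((p : Dbl) ^ 2)⁻¹ * (at1Hom R (lam p))⁻¹ * (at2Hom R (lam p))⁻¹ *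
        toDbl (twoVar R (univCoeff p w a b)) := by
  rw [← zeta1_eq, ← zeta2_eq]
  rfl

/-- `ω^a lam₁`. -/
noncomputable def l1 (R : Region) (p a : ℕ) : Dbl := at1Hom R (cst (omega p ^ a) * lam 1)

/-- `ω^b lam₂`. -/
noncomputable def l2 (R : Region) (p b : ℕ) : Dbl := at2Hom R (cst (omega p ^ b) * lam 1)

theorem kernelPart_eq (R : Region) (p : ℕ) (a b : ℕ) :
    toDbl (kernelPart R p a b) =
      (l1 R p a / ((p : Dbl) * at1Hom R (lam p))) * (l2 R p b / ((p : Dbl) * at2Hom R (lam p))) /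
        (l1 R p a - l2 R p b) ^ 2 := by
  have h1 : l1 R p a = toDbl (const2 (omega p ^ a) * lam1 R) := by
    have e : toDbl (lam1 R) = at1Hom R (lam 1) := at1_eq_hom R (lam 1)
    rw [l1, map_mul, at1_cst, ← e]
    rfl
  have h2 : l2 R p b = toDbl (const2 (omega p ^ b) * lam2 R) := by
    have e : toDbl (lam2 R) = at2Hom R (lam 1) := at2_eq_hom R (lam 1)
    rw [l2, map_mul, ← at1_cst_eq_at2_cst, at1_cst, ← e]
    rfl
  rw [h1, h2, ← zeta1_eq, ← zeta2_eq]
  rfl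

theorem ampA_eq (R : Region) (p : ℕ) (w : ℕ → ℕ → ℂ) (a b : ℕ) :
    toDbl (ampA R p w a b) = toDbl (kernelPart R p a b) + toDbl (universalPart R p w a b) := by
  have : toDbl (ampA R p w a b) = toDbl (kernelPart R p a b) - toDbl (deltaPart R p a b) +
      toDbl (universalPart R p w a b) + toDbl (deltaPart R p a b) := rfl
  rw [this]
  ring

theorem tw1_lam_p {p : ℕ} (hp : 0 < p) (a : ℕ) : tw1 (om p ^ a) (lam p) = lam p := by
  rw [tw1_lam, zpow_natCast, ← pow_mul, mul_comm a, pow_mul, (om_primitive hp).pow_eq_one, one_pow,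
    Units.val_one, map_one, one_mul]

theorem universalPart_eq_tw2 {p : ℕ} (hp : 0 < p) (R : Region) (w : ℕ → ℕ → ℂ) (a b : ℕ) :
    toDbl (universalPart R p w a b) =
      tw2 R (om p ^ a) (om p ^ b) (toDbl (universalPart R p w 0 0)) := by
  rw [universalPart_eq, universalPart_eq]
  simp only [map_mul, map_inv₀, map_pow, map_natCast, tw2_at1, tw2_at2, tw1_lam_p hp]
  congr 1
  refine c2_ext R fun k l => ?_
  rw [c2_tw2, c2_twoVar, c2_twoVar]
  split_ifs with h
  · obtain ⟨n, rfl⟩ : ∃ n : ℕ, k = -(n : ℤ) := ⟨(-k).toNat, by omega⟩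
    obtain ⟨m, rfl⟩ : ∃ m : ℕ, l = -(m : ℤ) := ⟨(-l).toNat, by omega⟩
    simp only [neg_neg, Int.toNat_natCast, univCoeff, mul_zero, pow_zero, mul_one]
    split_ifs
    · simp
    · have e : ∀ n a : ℕ, (((om p ^ a) ^ (-(n : ℤ)) : ℂˣ) : ℂ) = (omega p)⁻¹ ^ (n * a) := by
        intro n a
        rw [zpow_neg, zpow_natCast, ← pow_mul, mul_comm, ← inv_pow, Units.val_pow_eq_pow_val,
          Units.val_inv_eq_inv_val]
        rfl
      rw [e, e]
      ring
  · simp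

theorem kernelPart_eq_tw2 {p : ℕ} (hp : 0 < p) (R : Region) (a b : ℕ) :
    toDbl (kernelPart R p a b) =
      tw2 R (om p ^ a) (om p ^ b) (toDbl (kernelPart R p 0 0)) := by
  have e1 : tw2 R (om p ^ a) (om p ^ b) (l1 R p 0) = l1 R p a := by
    rw [l1, l1, tw2_at1, map_mul, tw1_cst, tw1_lam, pow_zero, map_one, one_mul, zpow_one]
    rfl
  have e2 : tw2 R (om p ^ a) (om p ^ b) (l2 R p 0) = l2 R p b := by
    rw [l2, l2, tw2_at2, map_mul, tw1_cst, tw1_lam, pow_zero, map_one, one_mul, zpow_one]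
    rfl
  rw [kernelPart_eq, kernelPart_eq]
  simp only [map_mul, map_div₀, map_sub, map_pow, map_natCast, tw2_at1, tw2_at2, tw1_lam_p hp, e1,
    e2]

theorem ampA_eq_tw2 {p : ℕ} (hp : 0 < p) (R : Region) (w : ℕ → ℕ → ℂ) (a b : ℕ) :
    toDbl (ampA R p w a b) = tw2 R (om p ^ a) (om p ^ b) (toDbl (ampA R p w 0 0)) := by
  rw [ampA_eq, ampA_eq, map_add, ← universalPart_eq_tw2 hp, ← kernelPart_eq_tw2 hp]

/-! ### Sheet sums as projections onto integer powers -/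

/-- `∑_{a,b} Q_a(ζ₁)^m A_{ab}(ζ₁,ζ₂) Q_b(ζ₂)^n`. -/
noncomputable def pairing (R : Region) (p : ℕ) (Q : ℕ → Ser) (A : ℕ → ℕ → Dbl) (m n : ℕ) : Dbl :=
  ∑ a ∈ Finset.range p, ∑ b ∈ Finset.range p,
    at1Hom R (Q a) ^ m * A a b * at2Hom R (Q b) ^ n

theorem sheetSum_eq (R : Region) (p : ℕ) (Q : ℕ → Ser) (A : ℕ → ℕ → Dbl) (s t : ℕ) :
    toDbl (sheetSum R p Q A s t) = pairing R p Q A (s - 1) (t - 1) := by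
  rw [pairing]
  simp only [← at1_eq_hom, ← at2_eq_hom]
  rfl

theorem natCast_eq_cst (R : Region) (n : ℕ) : (n : Dbl) = at1Hom R (cst n) := by
  rw [map_natCast, map_natCast]

/-- Each summand is a rotation of the (0, 0) summand, so the double sum factors into two sums of
roots of unity, each equal to p or 0. -/
theorem c2_pairing {p : ℕ} (hp : 0 < p) {R : Region} {Q : ℕ → Ser} {A : ℕ → ℕ → Dbl}
    (hQ : ∀ a, Q a = tw1 (om p ^ a) (Q 0))
    (hA : ∀ a b, A a b = tw2 R (om p ^ a) (om p ^ b) (A 0 0)) (m n : ℕ) (k l : ℤ) :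
    c2 R k l (pairing R p Q A m n) = if (p : ℤ) ∣ k ∧ (p : ℤ) ∣ l then
      (p : ℂ) ^ 2 * c2 R k l (at1Hom R (Q 0) ^ m * A 0 0 * at2Hom R (Q 0) ^ n) else 0 := by
  have h1 : ∀ a b, at1Hom R (Q a) ^ m * A a b * at2Hom R (Q b) ^ n =
      tw2 R (om p ^ a) (om p ^ b) (at1Hom R (Q 0) ^ m * A 0 0 * at2Hom R (Q 0) ^ n) := by
    intro a b
    rw [hQ a, hQ b, hA a b, map_mul, map_mul, map_pow, map_pow, tw2_at1, tw2_at2]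
  rw [pairing]
  rw [Finset.sum_congr rfl fun a _ => Finset.sum_congr rfl fun b _ => h1 a b]
  simp only [map_sum, c2_tw2]
  have h2 : ∀ z : ℂ, ∑ a ∈ Finset.range p, ∑ b ∈ Finset.range p,
      (((om p ^ a) ^ k : ℂˣ) : ℂ) * (((om p ^ b) ^ l : ℂˣ) : ℂ) * z =
      (∑ a ∈ Finset.range p, (((om p ^ a) ^ k : ℂˣ) : ℂ)) *
        (∑ b ∈ Finset.range p, (((om p ^ b) ^ l : ℂˣ) : ℂ)) * z := fun z => by
    rw [Finset.sum_mul_sum, Finset.sum_mul]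
    exact Finset.sum_congr rfl fun a _ => (Finset.sum_mul _ _ _).symm
  rw [h2, sum_om_pow hp, sum_om_pow hp]
  by_cases hk : (p : ℤ) ∣ k
  · by_cases hl : (p : ℤ) ∣ l
    · rw [if_pos hk, if_pos hl, if_pos ⟨hk, hl⟩, sq]
    · rw [if_neg hl, if_neg fun h : (p : ℤ) ∣ k ∧ (p : ℤ) ∣ l => hl h.2, mul_zero, zero_mul]
  · rw [if_neg hk, if_neg fun h : (p : ℤ) ∣ k ∧ (p : ℤ) ∣ l => hk h.1, zero_mul, zero_mul]

open Classical in
theorem c2_part (R : Region) (P : ℤ → ℤ → Prop) (f : Dbl) (k l : ℤ) :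
    c2 R k l (toDbl (part R P f)) = if P k l then c2 R k l f else 0 := by
  cases R
  · change (if P (- -k) (- -l) then c2 .I k l f else 0) = _
    rw [neg_neg, neg_neg]
  · change (if P (- -k) (- -l) then c2 .II k l f else 0) = _
    rw [neg_neg, neg_neg]

/-- The exponents of `lam₁`, `lam₂` in the image of `wPart`. -/
def Allowed (R : Region) (p : ℕ) (k l : ℤ) : Prop :=
  ∃ M N : ℤ, k = (p : ℤ) * M ∧ l = (p : ℤ) * N ∧ WAllowed R M N

open Classical in
theorem c2_ampG (R : Region) (p : ℕ) (Q : ℕ → Ser) (w : ℕ → ℕ → ℂ) (s t : ℕ) (k l : ℤ) :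
    c2 R k l (toDbl (ampG R p Q w s t)) = if Allowed R p k l then (p : ℂ) ^ 2 *
      c2 R k l (at1Hom R (Q 0) ^ (s - 1) * toDbl (ampA R p w 0 0) * at2Hom R (Q 0) ^ (t - 1))
      else 0 := by
  have h : toDbl (ampG R p Q w s t) = (p : Dbl) ^ 2 * toDbl (part R (Allowed R p)
      (at1Hom R (Q 0) ^ (s - 1) * toDbl (ampA R p w 0 0) * at2Hom R (Q 0) ^ (t - 1))) := by
    rw [← at1_eq_hom, ← at2_eq_hom]
    rfl
  rw [h, natCast_eq_cst R, ← map_pow, ← map_pow, c2_cst_mul, c2_part]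
  split_ifs <;> simp

open Classical in
theorem c2_ampGA (R : Region) (p : ℕ) (Q : ℕ → Ser) (w : ℕ → ℕ → ℂ) (s t : ℕ) (k l : ℤ) :
    c2 R k l (toDbl (ampGA R p Q w s t)) =
      if ∃ M N : ℕ, k = (p : ℤ) * M ∧ l = (p : ℤ) * N then (p : ℂ) ^ 2 *
      c2 R k l (at1Hom R (Q 0) ^ (s - 1) * toDbl (universalPart R p w 0 0) *
        at2Hom R (Q 0) ^ (t - 1)) else 0 := by
  have h : toDbl (ampGA R p Q w s t) = (p : Dbl) ^ 2 *
      toDbl (part R (fun k l => ∃ M N : ℕ, k = (p : ℤ) * M ∧ l = (p : ℤ) * N)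
      (at1Hom R (Q 0) ^ (s - 1) * toDbl (universalPart R p w 0 0) *
        at2Hom R (Q 0) ^ (t - 1))) := by
    rw [← at1_eq_hom, ← at2_eq_hom]
    rfl
  rw [h, natCast_eq_cst R, ← map_pow, ← map_pow, c2_cst_mul, c2_part]
  split_ifs <;> simp

open Classical in
-- At allowed exponents, which are multiples of p, both sides have the same coefficient
-- automatically. They can differ only where the W-projection cuts terms off, so equality is a
-- condition on the support alone.
theorem pairing_eq_ampG_iff {p : ℕ} (hp : 0 < p) {R : Region} {Q : ℕ → Ser} {w : ℕ → ℕ → ℂ}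
    (hQ : ∀ a, Q a = tw1 (om p ^ a) (Q 0)) (s t : ℕ) :
    pairing R p Q (fun a b => toDbl (ampA R p w a b)) (s - 1) (t - 1) = toDbl (ampG R p Q w s t) ↔
      ∀ k l, c2 R k l (pairing R p Q (fun a b => toDbl (ampA R p w a b)) (s - 1) (t - 1)) ≠ 0 → Allowed R p k l := by
  have hc := c2_pairing hp (R := R) hQ (A := fun a b => toDbl (ampA R p w a b)) (ampA_eq_tw2 hp R w) (s - 1) (t - 1)
  constructor
  · intro h k l hne
    rw [h, c2_ampG] at hne
    exact (ite_ne_right_iff.1 hne).1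
  · intro h
    refine c2_ext R fun k l => ?_
    have h1 := h k l
    rw [hc] at h1 ⊢
    rw [c2_ampG]
    by_cases ha : Allowed R p k l
    · have hd : (p : ℤ) ∣ k ∧ (p : ℤ) ∣ l := by
        obtain ⟨M, N, rfl, rfl, -⟩ := ha
        exact ⟨dvd_mul_right _ _, dvd_mul_right _ _⟩
      rw [if_pos ha, if_pos hd]
    · rw [if_neg ha]
      by_contra hne
      exact ha (h1 hne)

/-! ### Inversion of the linear system -/

/-- In matrix form the system is f(V) A g(V)ᵗ = G, and `L` is a two-sided inverse of V. Two
homomorphisms are needed because ζ₁ and ζ₂ are embedded separately. -/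
theorem bilinear_system_iff {S K : Type*} [CommRing S] [CommRing K] (f g : S →+* K) {p : ℕ}
    {Q : ℕ → S} {L : ℕ → ℕ → S}
    (h1 : ∀ a < p, ∀ c < p,
      ∑ s ∈ Finset.Icc 1 p, L a s * Q c ^ (s - 1) = if a = c then 1 else 0)
    (h2 : ∀ s ∈ Finset.Icc 1 p, ∀ t ∈ Finset.Icc 1 p,
      ∑ a ∈ Finset.range p, Q a ^ (s - 1) * L a t = if s = t then 1 else 0)
    (A G : ℕ → ℕ → K) :
    (∀ s ∈ Finset.Icc 1 p, ∀ t ∈ Finset.Icc 1 p, ∑ a ∈ Finset.range p, ∑ b ∈ Finset.range p,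
        f (Q a) ^ (s - 1) * A a b * g (Q b) ^ (t - 1) = G s t) ↔
      ∀ a < p, ∀ b < p, A a b = ∑ s ∈ Finset.Icc 1 p, ∑ t ∈ Finset.Icc 1 p,
        f (L a s) * g (L b t) * G s t := by
  constructor
  · intro hA a ha b hb
    have e1 : ∀ s ∈ Finset.Icc 1 p, ∀ t ∈ Finset.Icc 1 p,
        f (L a s) * g (L b t) * G s t =
        ∑ c ∈ Finset.range p, ∑ d ∈ Finset.range p,
          A c d * (f (L a s * Q c ^ (s - 1)) * g (L b t * Q d ^ (t - 1))) := by
      intro s hs t ht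
      rw [← hA s hs t ht, Finset.mul_sum]
      refine Finset.sum_congr rfl fun c _ => ?_
      rw [Finset.mul_sum]
      refine Finset.sum_congr rfl fun d _ => ?_
      simp only [map_mul, map_pow]
      ring
    rw [Finset.sum_congr rfl fun s hs => Finset.sum_congr rfl fun t ht => e1 s hs t ht]
    have e2 : ∑ c ∈ Finset.range p, ∑ d ∈ Finset.range p,
        A c d * ((if a = c then 1 else 0) * if b = d then 1 else 0) = A a b := by
      simp [ha, hb]
    rw [← e2]
    simp_rw [Finset.sum_comm (s := Finset.Icc 1 p) (t := Finset.range p)]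
    refine Finset.sum_congr rfl fun c hc => Finset.sum_congr rfl fun d hd => ?_
    simp_rw [← Finset.mul_sum]
    rw [← Finset.sum_mul, ← map_sum, ← map_sum, h1 a ha c (Finset.mem_range.1 hc),
      h1 b hb d (Finset.mem_range.1 hd)]
    split_ifs <;> simp
  · intro hA s hs t ht
    have e1 : ∀ a ∈ Finset.range p, ∀ b ∈ Finset.range p,
        f (Q a) ^ (s - 1) * A a b * g (Q b) ^ (t - 1) =
        ∑ c ∈ Finset.Icc 1 p, ∑ d ∈ Finset.Icc 1 p,
          G c d * (f (Q a ^ (s - 1) * L a c) * g (Q b ^ (t - 1) * L b d)) := by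
      intro a ha b hb
      rw [hA a (Finset.mem_range.1 ha) b (Finset.mem_range.1 hb), Finset.mul_sum, Finset.sum_mul]
      refine Finset.sum_congr rfl fun c _ => ?_
      rw [Finset.mul_sum, Finset.sum_mul]
      refine Finset.sum_congr rfl fun d _ => ?_
      simp only [map_mul, map_pow]
      ring
    rw [Finset.sum_congr rfl fun s hs => Finset.sum_congr rfl fun t ht => e1 s hs t ht]
    have e2 : ∑ c ∈ Finset.Icc 1 p, ∑ d ∈ Finset.Icc 1 p,
        G c d * ((if s = c then 1 else 0) * if t = d then 1 else 0) = G s t := by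
      simp only [mul_ite, mul_one, mul_zero, Finset.sum_ite_eq, hs, ht, if_true]
    rw [← e2]
    simp_rw [Finset.sum_comm (s := Finset.range p) (t := Finset.Icc 1 p)]
    refine Finset.sum_congr rfl fun c hc => Finset.sum_congr rfl fun d hd => ?_
    simp_rw [← Finset.mul_sum]
    rw [← Finset.sum_mul, ← map_sum, ← map_sum, h2 s hs c hc, h2 t ht d hd]
    split_ifs <;> simp

/-- `lagrangeCoeff` as an element of `Ser`. -/
noncomputable def lagr (p : ℕ) (Q : ℕ → Ser) (a s : ℕ) : Ser := toSer (lagrangeCoeff p Q a s)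

theorem lagr_eq (p : ℕ) (Q : ℕ → Ser) (a s : ℕ) :
    lagr p Q a s = (-1) ^ (p - s) * toSer (sigma p Q a (p - s)) *
      (∏ c ∈ (Finset.range p).erase a, (Q a - Q c))⁻¹ := rfl

theorem toDbl_inversion (R : Region) (p : ℕ) (Q : ℕ → Ser) (G : ℕ → ℕ → Double) (a b : ℕ) :
    toDbl (inversion R p Q G a b) =
      (at1Hom R (toSer (vdmErase p Q a)) * at2Hom R (toSer (vdmErase p Q b))) /
        (at1Hom R (toSer (vdm p Q)) * at2Hom R (toSer (vdm p Q))) *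
      ∑ s ∈ Finset.Icc 1 p, ∑ t ∈ Finset.Icc 1 p,
        (-1) ^ (a + b + s + t) * at1Hom R (toSer (sigma p Q a (p - s))) *
          at2Hom R (toSer (sigma p Q b (p - t))) * toDbl (G s t) := by
  simp only [← at1_eq_hom, ← at2_eq_hom]
  rfl

theorem inversion_eq {p : ℕ} {Q : ℕ → Ser} (h : Distinct p Q) (R : Region)
    (G : ℕ → ℕ → Double) {a b : ℕ} (ha : a < p) (hb : b < p) :
    toDbl (inversion R p Q G a b) = ∑ s ∈ Finset.Icc 1 p, ∑ t ∈ Finset.Icc 1 p,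
      at1Hom R (lagr p Q a s) * at2Hom R (lagr p Q b t) * toDbl (G s t) := by
  have key : ∀ a < p, ∀ s ∈ Finset.Icc 1 p,
      (-1) ^ (a + s) * (toSer (vdmErase p Q a) / toSer (vdm p Q)) * toSer (sigma p Q a (p - s)) =
      (-1) ^ (p - 1 + p) * lagr p Q a s := fun a ha s hs =>
    vdmErase_div_vdm h ha (Finset.mem_Icc.1 hs).2
  rw [toDbl_inversion, Finset.mul_sum]
  refine Finset.sum_congr rfl fun s hs => ?_
  rw [Finset.mul_sum]
  refine Finset.sum_congr rfl fun t ht => ?_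
  have h1 := congrArg (at1Hom R) (key a ha s hs)
  have h2 := congrArg (at2Hom R) (key b hb t ht)
  simp only [map_mul, map_pow, map_neg, map_one, map_div₀] at h1 h2
  have e1 : ((-1 : Dbl) ^ (p - 1 + p)) * (-1) ^ (p - 1 + p) = 1 := by
    rw [← mul_pow, show (-1 : Dbl) * -1 = 1 by ring, one_pow]
  rw [mul_div_mul_comm, show a + b + s + t = (a + s) + (b + t) by ring, pow_add]
  linear_combination ((-1) ^ (b + t) * (at2Hom R (toSer (vdmErase p Q b)) /
      at2Hom R (toSer (vdm p Q))) * at2Hom R (toSer (sigma p Q b (p - t)))) * toDbl (G s t) * h1 +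
    ((-1) ^ (p - 1 + p) * at1Hom R (lagr p Q a s)) * toDbl (G s t) * h2 +
    (at1Hom R (lagr p Q a s) * at2Hom R (lagr p Q b t) * toDbl (G s t)) * e1

theorem sum_lagr_mul_pow {p : ℕ} {Q : ℕ → Ser} (h : Distinct p Q) :
    ∀ a < p, ∀ c < p,
      ∑ s ∈ Finset.Icc 1 p, lagr p Q a s * Q c ^ (s - 1) = if a = c then 1 else 0 :=
  fun _ ha _ hc => sum_lagrangeCoeff_mul_pow h ha hc

theorem sheetSum_eq_iff {p : ℕ} {Q : ℕ → Ser} (h : Distinct p Q) (R : Region)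
    (A G : ℕ → ℕ → Double) :
    (∀ s ∈ Finset.Icc 1 p, ∀ t ∈ Finset.Icc 1 p, sheetSum R p Q A s t = G s t) ↔
      ∀ a < p, ∀ b < p, A a b = inversion R p Q G a b := by
  have key := bilinear_system_iff (at1Hom R) (at2Hom R) (sum_lagr_mul_pow h)
    (fun s hs t ht => sum_pow_mul_lagrangeCoeff h hs ht)
    (fun a b => toDbl (A a b)) (fun s t => toDbl (G s t))
  have e1 : ∀ s t, toDbl (sheetSum R p Q A s t) = ∑ a ∈ Finset.range p, ∑ b ∈ Finset.range p,
      at1Hom R (Q a) ^ (s - 1) * toDbl (A a b) * at2Hom R (Q b) ^ (t - 1) :=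
    fun s t => sheetSum_eq R p Q A s t
  refine (forall₂_congr fun s _ => forall₂_congr fun t _ => ?_).trans
    (key.trans (forall₂_congr fun a ha => forall₂_congr fun b hb => ?_))
  · rw [← e1]
    rfl
  · rw [← inversion_eq h R G ha hb]
    rfl

/-! ### Algebraic equation of the sheets and reduction to s, t ≤ p -/

/-- Newton's identities express k e_k through power sums and lower e_i; as `T` admits division by k,
all elementary symmetric functions lie in `T`. Vieta's formula then gives the equation satisfied by
every x_c. -/
theorem exists_monic_relation {S : Type*} [CommRing S] (T : Subring S)
    (hT : ∀ (k : ℕ) (x : S), k ≠ 0 → (k : S) * x ∈ T → x ∈ T) {n : ℕ} (x : Fin n → S)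
    (hx : ∀ k : ℕ, 1 ≤ k → ∑ i, x i ^ k ∈ T) :
    ∃ e : ℕ → S, (∀ j, e j ∈ T) ∧ ∀ c, x c ^ n = ∑ j ∈ Finset.range n, e j * x c ^ j := by
  have hmem : ∀ k : ℕ, MvPolynomial.aeval x (MvPolynomial.esymm (Fin n) ℤ k) ∈ T := by
    intro k
    induction k using Nat.strong_induction_on with
    | _ k ih =>
      rcases Nat.eq_zero_or_pos k with rfl | hk
      · rw [MvPolynomial.esymm_zero, map_one]
        exact T.one_mem
      · refine hT k _ hk.ne' ?_
        have h := congrArg (MvPolynomial.aeval x) (MvPolynomial.mul_esymm_eq_sum (Fin n) ℤ k)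
        rw [map_mul, map_natCast] at h
        rw [h, map_mul, map_sum]
        refine T.mul_mem ?_ (T.sum_mem fun a ha => ?_)
        · rw [map_pow, map_neg, map_one]
          exact T.pow_mem (T.neg_mem T.one_mem) _
        · rw [Finset.mem_filter, Finset.HasAntidiagonal.mem_antidiagonal] at ha
          rw [map_mul, map_mul, map_pow, map_neg, map_one]
          refine T.mul_mem (T.mul_mem (T.pow_mem (T.neg_mem T.one_mem) _) (ih _ ha.2)) ?_
          rw [MvPolynomial.psum, map_sum]
          simp only [map_pow, MvPolynomial.aeval_X]
          exact hx _ (by omega)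
  let s : Multiset S := Finset.univ.val.map x
  have hs : ∀ k, s.esymm k ∈ T := fun k => by
    rw [← MvPolynomial.aeval_esymm_eq_multiset_esymm (Fin n) ℤ]
    exact hmem k
  have hcard : s.card = n := by simp [s]
  refine ⟨fun j => -((-1) ^ (n - j) * s.esymm (n - j)), fun j => T.neg_mem
    (T.mul_mem (T.pow_mem (T.neg_mem T.one_mem) _) (hs _)), fun c => ?_⟩
  have h := congrArg (Polynomial.eval (x c)) (Multiset.prod_X_sub_X_eq_sum_esymm s)
  have h0 : Polynomial.eval (x c) (s.map fun t => Polynomial.X - Polynomial.C t).prod = 0 := by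
    rw [Polynomial.eval_multiset_prod, Multiset.map_map]
    refine Multiset.prod_eq_zero (Multiset.mem_map.2 ⟨x c, ?_, by simp⟩)
    exact Multiset.mem_map_of_mem x (Finset.mem_univ c)
  rw [h0, hcard, Polynomial.eval_finsetSum, ← Finset.sum_range_reflect, Finset.sum_range_succ] at h
  simp only [Polynomial.eval_mul, Polynomial.eval_pow, Polynomial.eval_neg, Polynomial.eval_one,
    Polynomial.eval_C, Polynomial.eval_X] at h
  rw [show n + 1 - 1 - n = 0 by omega, pow_zero, one_mul,
    show s.esymm 0 = 1 by simp [Multiset.esymm], one_mul, Nat.sub_zero] at h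
  simp only [neg_mul, Finset.sum_neg_distrib]
  rw [eq_neg_iff_add_eq_zero, add_comm]
  refine Eq.trans (congrArg (· + x c ^ n) (Finset.sum_congr rfl fun j hj => ?_)) h.symm
  have hj := Finset.mem_range.1 hj
  rw [show n + 1 - 1 - j = n - j by omega, show n - (n - j) = j by omega, mul_assoc]

/-- Series that only have exponents `lam ^ (p l) = ζ ^ l` with `l ≥ 0`. -/
noncomputable def PolSer (p : ℕ) : Subring Ser where
  carrier := {f | ∀ k, c1 k f ≠ 0 → ∃ l : ℕ, k = (p : ℤ) * l}
  zero_mem' k h := by simp at h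
  one_mem' k h := by
    rw [c1_one] at h
    exact ⟨0, by simpa using (ite_ne_right_iff.1 h).1⟩
  neg_mem' {f} hf k h := hf k (by rwa [map_neg, neg_ne_zero] at h)
  add_mem' {f g} hf hg k h := by
    rw [map_add] at h
    by_cases h0 : c1 k f = 0
    · exact hg k (by rwa [h0, zero_add] at h)
    · exact hf k h0
  mul_mem' {f g} hf hg k h := by
    obtain ⟨k₁, k₂, rfl, h1, h2⟩ := c1_mul_ne_zero h
    obtain ⟨l₁, rfl⟩ := hf _ h1
    obtain ⟨l₂, rfl⟩ := hg _ h2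
    exact ⟨l₁ + l₂, by push_cast; ring⟩

theorem lam_mem_polSer (p : ℕ) : lam p ∈ PolSer p := by
  intro k h
  have h1 := c1_cst_mul_lam k p 1
  rw [map_one, one_mul] at h1
  rw [h1] at h
  exact ⟨1, by simpa using (ite_ne_right_iff.1 h).1⟩

theorem natCast_eq_cst1 (n : ℕ) : (n : Ser) = cst n := by rw [map_natCast]

open Classical in
theorem c1_polPart (p : ℕ) (f : Ser) (k : ℤ) :
    c1 k (toSer (polPart p f)) = if ∃ l : ℕ, k = (p : ℤ) * l then c1 k f else 0 := by
  change (if ∃ l : ℕ, - -k = (p : ℤ) * l then c1 k f else 0) = _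
  rw [neg_neg]

theorem sa_mem_polSer (p : ℕ) (Q : ℕ → Ser) (s : ℕ) : toSer (sa p Q s) ∈ PolSer p := by
  have h : toSer (sa p Q s) = (p : Ser) * toSer (polPart p (Q 0 ^ s)) := rfl
  rw [h]
  refine (PolSer p).mul_mem (natCast_mem _ _) fun k hk => ?_
  by_contra hn
  exact hk ((c1_polPart p (Q 0 ^ s) k).trans (if_neg hn))

theorem sum_pow_eq_sa {p : ℕ} {Q : ℕ → Ser} (hdisk : DiskSD p Q) (s : ℕ) :
    ∑ a ∈ Finset.range p, Q a ^ s = toSer (sa p Q s) := by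
  -- The disk equations start at s = 1; for s = 0 both sides equal p, since the constant 1 is its
  -- own polynomial part.
  rcases Nat.eq_zero_or_pos s with rfl | hs
  · have h : toSer (sa p Q 0) = (p : Ser) * toSer (polPart p (1 : Ser)) := rfl
    have h1 : toSer (polPart p (1 : Ser)) = 1 := c1_ext fun k => by
      rw [c1_polPart, c1_one]
      split_ifs with h1 h2
      · rfl
      · rfl
      · exact absurd ⟨0, by simp [*]⟩ h1
      · rfl
    rw [h, h1]
    simp
  · exact hdisk s hs

theorem exists_sheet_relation {p : ℕ} {Q : ℕ → Ser} (hdisk : DiskSD p Q) :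
    ∃ e : ℕ → Ser, (∀ j, e j ∈ PolSer p) ∧
      ∀ a < p, Q a ^ p = ∑ j ∈ Finset.range p, e j * Q a ^ j := by
  obtain ⟨e, he, h⟩ := exists_monic_relation (PolSer p) (fun k x hk h i hi => h i (by
    rw [natCast_eq_cst1, c1_cst_mul]
    exact mul_ne_zero (Nat.cast_ne_zero.2 hk) hi)) (fun i : Fin p => Q i) (fun k _ => by
      have := sum_pow_eq_sa hdisk k
      rw [Finset.sum_range] at this
      rw [this]
      exact sa_mem_polSer p Q k)
  exact ⟨e, he, fun a ha => h ⟨a, ha⟩⟩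

/-- The constraints are lower bounds on M or N and on M + N. Hence the allowed series form a module
over the polynomials in ζ₁ and ζ₂. -/
theorem WAllowed.add_left {R : Region} {M N : ℤ} (h : WAllowed R M N) (n : ℕ) :
    WAllowed R (n + M) N := by
  cases R <;> simp only [WAllowed] at * <;> omega

theorem WAllowed.add_right {R : Region} {M N : ℤ} (h : WAllowed R M N) (n : ℕ) :
    WAllowed R M (n + N) := by
  cases R <;> simp only [WAllowed] at * <;> omega

/-- The additive group of double series all of whose exponents are allowed. -/
noncomputable def AllowedSer (R : Region) (p : ℕ) : AddSubgroup Dbl where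
  carrier := {f | ∀ k l, c2 R k l f ≠ 0 → Allowed R p k l}
  zero_mem' k l h := by simp at h
  neg_mem' {f} hf k l h := hf k l (by rwa [map_neg, neg_ne_zero] at h)
  add_mem' {f g} hf hg k l h := by
    rw [map_add] at h
    by_cases h0 : c2 R k l f = 0
    · exact hg k l (by rwa [h0, zero_add] at h)
    · exact hf k l h0

theorem at1_mul_mem_allowedSer {R : Region} {p : ℕ} {e : Ser} (he : e ∈ PolSer p) {f : Dbl}
    (hf : f ∈ AllowedSer R p) : at1Hom R e * f ∈ AllowedSer R p := by
  intro k l h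
  obtain ⟨k₁, k₂, l₁, l₂, rfl, rfl, h1, h2⟩ := c2_mul_ne_zero h
  rw [c2_at1] at h1
  obtain ⟨rfl, h1⟩ := ite_ne_right_iff.1 h1
  obtain ⟨n, rfl⟩ := he _ h1
  obtain ⟨M, N, rfl, rfl, h3⟩ := hf _ _ h2
  exact ⟨n + M, N, by ring, by ring, h3.add_left n⟩

theorem at2_mul_mem_allowedSer {R : Region} {p : ℕ} {e : Ser} (he : e ∈ PolSer p) {f : Dbl}
    (hf : f ∈ AllowedSer R p) : at2Hom R e * f ∈ AllowedSer R p := by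
  intro k l h
  obtain ⟨k₁, k₂, l₁, l₂, rfl, rfl, h1, h2⟩ := c2_mul_ne_zero h
  rw [c2_at2] at h1
  obtain ⟨rfl, h1⟩ := ite_ne_right_iff.1 h1
  obtain ⟨n, rfl⟩ := he _ h1
  obtain ⟨M, N, rfl, rfl, h3⟩ := hf _ _ h2
  exact ⟨M, n + N, by ring, by ring, h3.add_right n⟩

/-- The degree-p equation of the sheets turns into linear recurrences for the pairings in m and in
n, with coefficients polynomial in one ζ; strong induction is applied to m first and then to n. -/
theorem pairing_mem_of_small {p : ℕ} {R : Region} {Q : ℕ → Ser} (hdisk : DiskSD p Q)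
    {A : ℕ → ℕ → Dbl} (h : ∀ m < p, ∀ n < p, pairing R p Q A m n ∈ AllowedSer R p) (m n : ℕ) :
    pairing R p Q A m n ∈ AllowedSer R p := by
  obtain ⟨e, he, hQ⟩ := exists_sheet_relation hdisk
  have step1 : ∀ m n, pairing R p Q A (m + p) n =
      ∑ j ∈ Finset.range p, at1Hom R (e j) * pairing R p Q A (m + j) n := by
    intro m n
    simp only [pairing, Finset.mul_sum]
    refine Eq.trans (Finset.sum_congr rfl fun a ha => ?_) Finset.sum_comm
    refine Eq.trans (Finset.sum_congr rfl fun b _ => ?_) Finset.sum_comm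
    have := congrArg (at1Hom R) (hQ a (Finset.mem_range.1 ha))
    rw [map_pow, map_sum] at this
    rw [pow_add, this, Finset.mul_sum, Finset.sum_mul, Finset.sum_mul]
    refine Finset.sum_congr rfl fun j _ => ?_
    rw [map_mul, map_pow]
    ring
  have step2 : ∀ m n, pairing R p Q A m (n + p) =
      ∑ j ∈ Finset.range p, at2Hom R (e j) * pairing R p Q A m (n + j) := by
    intro m n
    simp only [pairing, Finset.mul_sum]
    refine Eq.trans (Finset.sum_congr rfl fun a _ => ?_) Finset.sum_comm
    refine Eq.trans (Finset.sum_congr rfl fun b hb => ?_) Finset.sum_comm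
    have := congrArg (at2Hom R) (hQ b (Finset.mem_range.1 hb))
    rw [map_pow, map_sum] at this
    rw [pow_add, this, Finset.mul_sum, Finset.mul_sum]
    refine Finset.sum_congr rfl fun j _ => ?_
    rw [map_mul, map_pow]
    ring
  have h1 : ∀ m, ∀ n < p, pairing R p Q A m n ∈ AllowedSer R p := by
    intro m
    induction m using Nat.strong_induction_on with
    | _ m ih =>
      intro n hn
      by_cases hm : m < p
      · exact h m hm n hn
      · obtain ⟨m', rfl⟩ : ∃ m', m = m' + p := ⟨m - p, by omega⟩
        rw [step1]
        refine sum_mem fun j hj => at1_mul_mem_allowedSer (he j) (ih _ ?_ n hn)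
        have := Finset.mem_range.1 hj
        omega
  induction n using Nat.strong_induction_on with
  | _ n ih =>
    by_cases hn : n < p
    · exact h1 m n hn
    · obtain ⟨n', rfl⟩ : ∃ n', n = n' + p := ⟨n - p, by omega⟩
      rw [step2]
      refine sum_mem fun j hj => at2_mul_mem_allowedSer (he j) (ih _ ?_)
      have := Finset.mem_range.1 hj
      omega

theorem annulusSD_iff {p : ℕ} (hp : 0 < p) {Q : ℕ → Ser} (hQ : ∀ a, Q a = tw1 (om p ^ a) (Q 0))
    (w : ℕ → ℕ → ℂ) (s t : ℕ) :
    AnnulusSD p Q w s t ↔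
      ∀ R, pairing R p Q (fun a b => toDbl (ampA R p w a b)) (s - 1) (t - 1) ∈ AllowedSer R p := by
  refine forall_congr' fun R => ?_
  refine Iff.trans ?_ (pairing_eq_ampG_iff hp hQ s t)
  rw [← sheetSum_eq R p Q (fun a b => toDbl (ampA R p w a b)) s t]
  rfl

theorem annulusSD_tfae {p : ℕ} (hp : 0 < p) {Q : ℕ → Ser}
    (hQ : ∀ a, Q a = tw1 (om p ^ a) (Q 0)) (hdist : Distinct p Q) (hdisk : DiskSD p Q)
    (w : ℕ → ℕ → ℂ) : List.TFAE [
      ∀ s t : ℕ, 1 ≤ s → 1 ≤ t → AnnulusSD p Q w s t,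
      ∀ s ∈ Finset.Icc 1 p, ∀ t ∈ Finset.Icc 1 p, AnnulusSD p Q w s t,
      ∀ R : Region, ∀ a < p, ∀ b < p,
        conn R p w a b = inversion R p Q (ampG R p Q w) a b - deltaPart R p a b] := by
  tfae_have 1 → 2 := fun h s hs t ht => h s t (Finset.mem_Icc.1 hs).1 (Finset.mem_Icc.1 ht).1
  tfae_have 2 → 1 := by
    intro h s t _ _
    rw [annulusSD_iff hp hQ]
    intro R
    refine pairing_mem_of_small hdisk (fun m hm n hn => ?_) _ _
    have := h (m + 1) (Finset.mem_Icc.2 (by omega)) (n + 1) (Finset.mem_Icc.2 (by omega))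
    exact (annulusSD_iff hp hQ w _ _).1 this R
  tfae_have 2 ↔ 3 := by
    have h1 : (∀ s ∈ Finset.Icc 1 p, ∀ t ∈ Finset.Icc 1 p, AnnulusSD p Q w s t) ↔
        ∀ R : Region, ∀ s ∈ Finset.Icc 1 p, ∀ t ∈ Finset.Icc 1 p,
          sheetSum R p Q (ampA R p w) s t = ampG R p Q w s t :=
      ⟨fun h R s hs t ht => h s hs t ht R, fun h s hs t ht R => h R s hs t ht⟩
    rw [h1]
    refine forall_congr' fun R => (sheetSum_eq_iff hdist R _ _).trans ?_
    refine forall₂_congr fun a _ => forall₂_congr fun b _ => ?_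
    -- `ampA` is by definition `conn` plus `deltaPart`.
    exact (eq_sub_iff_add_eq (G := Dbl)).symm
  tfae_finish

/-! ### Clearing the double pole -/

/-- `ζ₁ - ζ₂`. -/
noncomputable def zdiff (p : ℕ) (R : Region) : Dbl := at1Hom R (lam p) - at2Hom R (lam p)

theorem l1_sub_l2_ne_zero (R : Region) (p a b : ℕ) : l1 R p a - l2 R p b ≠ 0 := by
  intro h
  have h1 := congrArg (c2 R 1 0) h
  rw [map_sub, l1, l2, c2_at1, c2_at2, if_pos rfl, if_neg one_ne_zero, sub_zero, map_zero,
    c1_cst_mul_lam, if_pos rfl] at h1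
  exact pow_ne_zero _ (Complex.exp_ne_zero _) h1

theorem zdiff_ne_zero {p : ℕ} (hp : 0 < p) (R : Region) : zdiff p R ≠ 0 := by
  intro h
  have h1 := congrArg (c2 R p 0) h
  have h2 := c1_cst_mul_lam p p 1
  rw [map_one, one_mul, if_pos rfl] at h2
  rw [zdiff, map_sub, c2_at1, c2_at2, if_pos rfl, if_neg (by omega), sub_zero, map_zero, h2] at h1
  exact one_ne_zero h1

theorem omega_pow_pow {p : ℕ} (hp : 0 < p) (a : ℕ) : (omega p ^ a) ^ p = 1 := by
  have h : omega p ^ p = 1 := (Complex.isPrimitiveRoot_exp p hp.ne').pow_eq_one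
  rw [← pow_mul, mul_comm, pow_mul, h, one_pow]

theorem l1_pow {p : ℕ} (hp : 0 < p) (R : Region) (a : ℕ) : l1 R p a ^ p = at1Hom R (lam p) := by
  rw [l1, ← map_pow, mul_pow, ← map_pow, omega_pow_pow hp, map_one, one_mul, lam_pow, one_mul]

theorem l2_pow {p : ℕ} (hp : 0 < p) (R : Region) (a : ℕ) : l2 R p a ^ p = at2Hom R (lam p) := by
  rw [l2, ← map_pow, mul_pow, ← map_pow, omega_pow_pow hp, map_one, one_mul, lam_pow, one_mul]

theorem natCast_mul_at1_inv {p : ℕ} (R : Region) :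
    ((p : Dbl) * at1Hom R (lam p))⁻¹ = at1Hom R (cst (p : ℂ)⁻¹ * lam (-p)) := by
  rw [natCast_eq_cst R, ← map_mul, ← map_inv₀, mul_inv, lam_inv, map_inv₀ cst]

theorem natCast_mul_at2_inv {p : ℕ} (R : Region) :
    ((p : Dbl) * at2Hom R (lam p))⁻¹ = at2Hom R (cst (p : ℂ)⁻¹ * lam (-p)) := by
  rw [natCast_eq_cst R, at1_cst_eq_at2_cst, ← map_mul, ← map_inv₀, mul_inv, lam_inv,
    map_inv₀ cst]

/-- ω^a λ₁ and ω^b λ₂ are p-th roots of ζ₁ and ζ₂, so their difference divides ζ₁ - ζ₂ with a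
geometric sum as quotient. The pole cancels and a Laurent polynomial remains. -/
theorem zdiff_sq_mul_kernelPart {p : ℕ} (hp : 0 < p) (R : Region) (a b : ℕ) :
    zdiff p R ^ 2 * toDbl (kernelPart R p a b) =
      (∑ i ∈ Finset.range p, l1 R p a ^ i * l2 R p b ^ (p - 1 - i)) ^ 2 *
        (l1 R p a * at1Hom R (cst (p : ℂ)⁻¹ * lam (-p))) *
        (l2 R p b * at2Hom R (cst (p : ℂ)⁻¹ * lam (-p))) := by
  have h1 : zdiff p R = (l1 R p a - l2 R p b) *
      ∑ i ∈ Finset.range p, l1 R p a ^ i * l2 R p b ^ (p - 1 - i) := by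
    rw [mul_comm, (Commute.all _ _).geom_sum₂_mul, l1_pow hp, l2_pow hp, zdiff]
  rw [kernelPart_eq, h1, ← natCast_mul_at1_inv, ← natCast_mul_at2_inv]
  generalize (∑ i ∈ Finset.range p, l1 R p a ^ i * l2 R p b ^ (p - 1 - i)) = S
  have h2 := pow_ne_zero 2 (l1_sub_l2_ne_zero R p a b)
  rw [div_eq_mul_inv (_ * _) ((l1 R p a - l2 R p b) ^ 2), mul_pow]
  simp only [div_eq_mul_inv]
  linear_combination (S ^ 2 * (l1 R p a * ((p : Dbl) * at1Hom R (lam p))⁻¹) *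
        (l2 R p b * ((p : Dbl) * at2Hom R (lam p))⁻¹)) * (mul_inv_cancel₀ h2)

theorem reg_of_eq {f g : Region → Dbl} (hg : g ∈ Reg) (h : ∀ R, f R = g R) : f ∈ Reg :=
  (funext h : f = g) ▸ hg

theorem zdiff_mem_reg (p : ℕ) : zdiff p ∈ Reg :=
  Reg.sub_mem (at1_mem_reg (lam p)) (at2_mem_reg (lam p))

/-- The kernel itself has different expansions in the two regions; only after clearing the pole do
they coincide. -/
theorem kernelPart_mem_reg {p : ℕ} (hp : 0 < p) (a b : ℕ) :
    (fun R => zdiff p R ^ 2 * toDbl (kernelPart R p a b)) ∈ Reg := by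
  have h1 : (fun R => l1 R p a) ∈ Reg := at1_mem_reg _
  have h2 : (fun R => l2 R p b) ∈ Reg := at2_mem_reg _
  have h3 := at1_mem_reg (cst (p : ℂ)⁻¹ * lam (-p))
  have h4 := at2_mem_reg (cst (p : ℂ)⁻¹ * lam (-p))
  have h5 : (∑ i ∈ Finset.range p, (fun R => l1 R p a) ^ i * (fun R => l2 R p b) ^ (p - 1 - i)) ∈
      Reg := Reg.sum_mem fun i _ => Reg.mul_mem (Reg.pow_mem h1 i) (Reg.pow_mem h2 _)
  refine reg_of_eq (Reg.mul_mem (Reg.mul_mem (Reg.pow_mem h5 2) (Reg.mul_mem h1 h3))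
    (Reg.mul_mem h2 h4)) fun R => ?_
  rw [zdiff_sq_mul_kernelPart hp]
  simp only [Pi.mul_apply, Pi.pow_apply, Finset.sum_apply]

theorem universalPart_mem_reg (p : ℕ) (w : ℕ → ℕ → ℂ) (a b : ℕ) :
    (fun R => toDbl (universalPart R p w a b)) ∈ Reg := by
  refine reg_of_eq (Reg.mul_mem (Reg.mul_mem (at1_mem_reg (cst ((p : ℂ) ^ 2)⁻¹ * lam (-p)))
    (at2_mem_reg (lam (-p)))) (twoVar_mem_reg (univCoeff p w a b))) fun R => ?_
  rw [universalPart_eq, natCast_eq_cst R, ← map_pow, ← map_pow, ← map_inv₀, ← map_inv₀,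
    ← map_inv₀, ← map_inv₀, lam_inv, ← map_mul]
  rfl

theorem pairing_mem_reg {p : ℕ} (Q : ℕ → Ser) {A : Region → ℕ → ℕ → Dbl}
    (hA : ∀ a b, (fun R => A R a b) ∈ Reg) (m n : ℕ) :
    (fun R => pairing R p Q (A R) m n) ∈ Reg := by
  refine reg_of_eq (Reg.sum_mem fun a (_ : a ∈ Finset.range p) =>
    Reg.sum_mem fun b (_ : b ∈ Finset.range p) => Reg.mul_mem (Reg.mul_mem
      (Reg.pow_mem (at1_mem_reg (Q a)) m) (hA a b)) (Reg.pow_mem (at2_mem_reg (Q b)) n))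
    fun R => ?_
  simp only [pairing, Finset.sum_apply, Pi.mul_apply, Pi.pow_apply]

theorem mul_pairing (R : Region) (p : ℕ) (Q : ℕ → Ser) (A : ℕ → ℕ → Dbl) (m n : ℕ) (z : Dbl) :
    z * pairing R p Q A m n = pairing R p Q (fun a b => z * A a b) m n := by
  simp only [pairing, Finset.mul_sum]
  exact Finset.sum_congr rfl fun a _ => Finset.sum_congr rfl fun b _ => by ring

theorem pairing_sub (R : Region) (p : ℕ) (Q : ℕ → Ser) (A B : ℕ → ℕ → Dbl) (m n : ℕ) :
    pairing R p Q A m n - pairing R p Q B m n = pairing R p Q (fun a b => A a b - B a b) m n := by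
  simp only [pairing, ← Finset.sum_sub_distrib]
  exact Finset.sum_congr rfl fun a _ => Finset.sum_congr rfl fun b _ => by ring

/-- The coefficients agree, so an exponent that occurs must satisfy the constraints of both regions:
region I gives N ≥ 0 and region II gives M ≥ 0. -/
theorem exists_nat_of_allowed {p : ℕ} {f : Region → Dbl} (hf : f ∈ Reg)
    (h : ∀ R, f R ∈ AllowedSer R p) (R : Region) (k l : ℤ) (hne : c2 R k l (f R) ≠ 0) :
    ∃ M N : ℕ, k = (p : ℤ) * M ∧ l = (p : ℤ) * N := by
  obtain ⟨M, N, rfl, rfl, hI⟩ := h .I k l (by rwa [Reg.coeff_eq hf .I R])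
  obtain ⟨M', N', hM, hN, hII⟩ := h .II _ _ (by rwa [Reg.coeff_eq hf .II R])
  simp only [WAllowed] at hI hII
  -- Each witness comes from the region that bounds it, so the two representations of an exponent
  -- need not be compared by dividing by p.
  refine ⟨M'.toNat, N.toNat, ?_, ?_⟩
  · rw [Int.toNat_of_nonneg hII.1]; exact hM
  · rw [Int.toNat_of_nonneg hI.1]

theorem zdiff_mul_mem_allowedSer {R : Region} {p : ℕ} {f : Dbl} (hf : f ∈ AllowedSer R p) :
    zdiff p R * f ∈ AllowedSer R p := by
  rw [zdiff, sub_mul]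
  exact sub_mem (at1_mul_mem_allowedSer (lam_mem_polSer p) hf)
    (at2_mul_mem_allowedSer (lam_mem_polSer p) hf)

open Classical in
theorem ampGA_mem_reg (p : ℕ) (Q : ℕ → Ser) (w : ℕ → ℕ → ℂ) (s t : ℕ) :
    (fun R => toDbl (ampGA R p Q w s t)) ∈ Reg := by
  have h : (fun R => at1Hom R (Q 0) ^ (s - 1) * toDbl (universalPart R p w 0 0) *
      at2Hom R (Q 0) ^ (t - 1)) ∈ Reg :=
    Reg.mul_mem (Reg.mul_mem (Reg.pow_mem (at1_mem_reg _) _) (universalPart_mem_reg p w 0 0))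
      (Reg.pow_mem (at2_mem_reg _) _)
  obtain ⟨K, hK⟩ := h.2
  refine ⟨fun k l => by rw [c2_ampGA, c2_ampGA, Reg.coeff_eq h .I .II], K, fun R k l hne => ?_⟩
  rw [c2_ampGA] at hne
  exact hK R k l (right_ne_zero_of_mul (ite_ne_right_iff.1 hne).2)

open Classical in
theorem exists_polynomial_ampGA {p : ℕ} (hp : 0 < p) (Q : ℕ → Ser) (w : ℕ → ℕ → ℂ) (s t : ℕ) :
    ∃ B : MvPolynomial (Fin 2) ℂ, ∀ R, evalHom R p B = toDbl (ampGA R p Q w s t) :=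
  exists_polynomial hp (ampGA_mem_reg p Q w s t) fun R k l hne => by
    rw [c2_ampGA] at hne
    exact (ite_ne_right_iff.1 hne).1

/-! ### The polynomials B^N -/

theorem exists_polynomial_sa {p : ℕ} (hp : 0 < p) (Q : ℕ → Ser) (s t : ℕ) :
    ∃ B : MvPolynomial (Fin 2) ℂ, ∀ R, evalHom R p B =
      (p : Dbl)⁻¹ * at1Hom R (toSer (sa p Q s)) * at2Hom R (toSer (sa p Q t)) := by
  have h : (fun R => at1Hom R (cst (p : ℂ)⁻¹ * toSer (sa p Q s)) *
      at2Hom R (toSer (sa p Q t))) ∈ Reg := Reg.mul_mem (at1_mem_reg _) (at2_mem_reg _)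
  obtain ⟨B, hB⟩ := exists_polynomial hp h fun R k l hne => by
    obtain ⟨k₁, k₂, l₁, l₂, rfl, rfl, h1, h2⟩ := c2_mul_ne_zero hne
    rw [c2_at1, c1_cst_mul] at h1
    rw [c2_at2] at h2
    obtain ⟨rfl, h1⟩ := ite_ne_right_iff.1 h1
    obtain ⟨rfl, h2⟩ := ite_ne_right_iff.1 h2
    obtain ⟨M, rfl⟩ := sa_mem_polSer p Q s _ (right_ne_zero_of_mul h1)
    obtain ⟨N, rfl⟩ := sa_mem_polSer p Q t _ h2
    exact ⟨M, N, by ring, by ring⟩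
  refine ⟨B, fun R => ?_⟩
  rw [hB, map_mul, natCast_eq_cst R, ← map_inv₀, ← map_inv₀]

/-- The sheet sum of the annulus amplitudes. -/
noncomputable def ampPairing (R : Region) (p : ℕ) (Q : ℕ → Ser) (w : ℕ → ℕ → ℂ) (s t : ℕ) : Dbl :=
  pairing R p Q (fun a b => toDbl (ampA R p w a b)) (s - 1) (t - 1)

theorem exists_polynomial_ampPairing {p : ℕ} (hp : 0 < p) (Q : ℕ → Ser) (w : ℕ → ℕ → ℂ) (s t : ℕ)
    (h : ∀ R, ampPairing R p Q w s t ∈ AllowedSer R p) :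
    ∃ B : MvPolynomial (Fin 2) ℂ, ∀ R,
      evalHom R p B = zdiff p R ^ 2 * ampPairing R p Q w s t := by
  have h1 : (fun R => zdiff p R ^ 2 * ampPairing R p Q w s t) ∈ Reg := by
    simp only [ampPairing, mul_pairing]
    refine pairing_mem_reg Q (A := fun R a b => zdiff p R ^ 2 * toDbl (ampA R p w a b))
      (fun a b => ?_) _ _
    simp only [ampA_eq, mul_add]
    exact Reg.add_mem (kernelPart_mem_reg hp a b)
      (Reg.mul_mem (Reg.pow_mem (zdiff_mem_reg p) 2) (universalPart_mem_reg p w a b))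
  refine exists_polynomial hp h1 (exists_nat_of_allowed h1 fun R => ?_)
  rw [sq, mul_assoc]
  exact zdiff_mul_mem_allowedSer (zdiff_mul_mem_allowedSer (h R))

open Classical in
-- The kernel does not depend on `w` and cancels in the difference, leaving universal parts only,
-- which have no pole. Being allowed in both regions, the difference is a polynomial; it therefore
-- equals its own polynomial part, which is computed by `G^A`.
theorem ampPairing_sub_eq {p : ℕ} (hp : 0 < p) {Q : ℕ → Ser}
    (hQ : ∀ a, Q a = tw1 (om p ^ a) (Q 0)) (w w' : ℕ → ℕ → ℂ) (s t : ℕ)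
    (h : ∀ R, ampPairing R p Q w s t ∈ AllowedSer R p)
    (h' : ∀ R, ampPairing R p Q w' s t ∈ AllowedSer R p) (R : Region) :
    ampPairing R p Q w s t - ampPairing R p Q w' s t =
      toDbl (ampGA R p Q w s t) - toDbl (ampGA R p Q w' s t) := by
  have h1 : ∀ R, ampPairing R p Q w s t - ampPairing R p Q w' s t =
      pairing R p Q (fun a b => toDbl (universalPart R p w a b)) (s - 1) (t - 1) -
        pairing R p Q (fun a b => toDbl (universalPart R p w' a b)) (s - 1) (t - 1) := by
    intro R
    simp only [ampPairing, pairing_sub, ampA_eq, add_sub_add_left_eq_sub]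
  have hreg : (fun R => ampPairing R p Q w s t - ampPairing R p Q w' s t) ∈ Reg := by
    simp only [h1]
    exact Reg.sub_mem (pairing_mem_reg Q (universalPart_mem_reg p w) _ _)
      (pairing_mem_reg Q (universalPart_mem_reg p w') _ _)
  have hnat := exists_nat_of_allowed hreg fun R => sub_mem (h R) (h' R)
  refine c2_ext R fun k l => ?_
  have hu := fun w => c2_pairing hp (R := R) hQ
    (A := fun a b => toDbl (universalPart R p w a b)) (universalPart_eq_tw2 hp R w)
    (s - 1) (t - 1) k l
  by_cases hkl : ∃ M N : ℕ, k = (p : ℤ) * M ∧ l = (p : ℤ) * N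
  · have hd : (p : ℤ) ∣ k ∧ (p : ℤ) ∣ l := by
      obtain ⟨M, N, rfl, rfl⟩ := hkl
      exact ⟨dvd_mul_right _ _, dvd_mul_right _ _⟩
    rw [h1, map_sub, map_sub, c2_ampGA, c2_ampGA, hu, hu, if_pos hd, if_pos hd, if_pos hkl,
      if_pos hkl]
  · rw [map_sub _ (toDbl _), c2_ampGA, c2_ampGA, if_neg hkl, if_neg hkl, sub_zero]
    by_contra hne
    exact hkl (hnat R k l hne)

theorem exists_universal_polynomial {p : ℕ} (hp : 0 < p) {Q : ℕ → Ser}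
    (hQ : ∀ a, Q a = tw1 (om p ^ a) (Q 0)) (s t : ℕ) :
    ∃ BN : MvPolynomial (Fin 2) ℂ, ∀ w : ℕ → ℕ → ℂ,
      (∀ R, ampPairing R p Q w s t ∈ AllowedSer R p) → ∀ R,
        zdiff p R ^ 2 * ampPairing R p Q w s t =
          (p : Dbl)⁻¹ * at1Hom R (toSer (sa p Q (s - 1))) * at2Hom R (toSer (sa p Q (t - 1))) +
            (evalHom R p BN + zdiff p R ^ 2 * toDbl (ampGA R p Q w s t)) := by
  -- One reference solution w₀ fixes B^N; without any solution the claim is vacuous.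
  by_cases h0 : ∃ w₀ : ℕ → ℕ → ℂ, ∀ R, ampPairing R p Q w₀ s t ∈ AllowedSer R p
  · obtain ⟨w₀, h0⟩ := h0
    obtain ⟨Y, hY⟩ := exists_polynomial_ampPairing hp Q w₀ s t h0
    obtain ⟨S, hS⟩ := exists_polynomial_sa hp Q (s - 1) (t - 1)
    obtain ⟨GA, hGA⟩ := exists_polynomial_ampGA hp Q w₀ s t
    refine ⟨Y - S - (MvPolynomial.X 0 - MvPolynomial.X 1) ^ 2 * GA, fun w hw R => ?_⟩
    have hX : evalHom R p (MvPolynomial.X 0 - MvPolynomial.X 1) = zdiff p R := by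
      rw [map_sub]
      simp [evalHom, zdiff]
    rw [map_sub, map_sub, map_mul, map_pow, hX, hY, hS, hGA]
    linear_combination zdiff p R ^ 2 * ampPairing_sub_eq hp hQ w w₀ s t hw h0 R
  · exact ⟨0, fun w hw => absurd ⟨w, hw⟩ h0⟩

/-! ### The formula for F_ab -/

theorem eval_derivative_prod_X_sub_C {K : Type*} [CommRing K] (s : Finset ℕ) (Q : ℕ → K) {a : ℕ}
    (ha : a ∈ s) :
    (Polynomial.derivative (∏ i ∈ s, (Polynomial.X - Polynomial.C (Q i)))).eval (Q a) =
      ∏ i ∈ s.erase a, (Q a - Q i) := by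
  rw [← Finset.mul_prod_erase s _ ha, Polynomial.derivative_mul]
  simp [Polynomial.eval_prod]

theorem toSer_curveF' {p : ℕ} (Q : ℕ → Ser) {a : ℕ} (ha : a < p) :
    toSer (curveF' p Q a) = ∏ i ∈ (Finset.range p).erase a, (Q a - Q i) :=
  eval_derivative_prod_X_sub_C (Finset.range p) Q (Finset.mem_range.2 ha)

/-- By the disk equations the s-th factor is the power sum of the sheets of exponent s - 1, and the
Lagrange coefficients of sheet a select the single term c = a. This makes the disk term contribute
exactly 1/p. -/
theorem sum_lagr_mul_sa {p : ℕ} {Q : ℕ → Ser} (h : Distinct p Q) (hdisk : DiskSD p Q) {a : ℕ}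
    (ha : a < p) : ∑ s ∈ Finset.Icc 1 p, lagr p Q a s * toSer (sa p Q (s - 1)) = 1 := by
  simp only [← sum_pow_eq_sa hdisk, Finset.mul_sum]
  rw [Finset.sum_comm, Finset.sum_congr rfl fun c hc =>
    sum_lagr_mul_pow h a ha c (Finset.mem_range.1 hc)]
  simp [ha]

theorem toDbl_ampF (R : Region) (p : ℕ) (Q : ℕ → Ser) (B : ℕ → ℕ → MvPolynomial (Fin 2) ℂ)
    (a b : ℕ) :
    toDbl (ampF R p Q B a b) =
      (p : Dbl)⁻¹ * at1Hom R (toSer (curveF' p Q a)) * at2Hom R (toSer (curveF' p Q b)) +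
        ∑ s ∈ Finset.Icc 1 p, ∑ t ∈ Finset.Icc 1 p,
          (-1) ^ (s + t) * at1Hom R (toSer (sigma p Q a (p - s))) *
            at2Hom R (toSer (sigma p Q b (p - t))) * evalHom R p (B s t) := by
  simp only [← at1_eq_hom, ← at2_eq_hom, ← evalZeta_eq]
  rfl

theorem amplitude_eq_ampF {p : ℕ} (hp : 0 < p) {Q : ℕ → Ser} (h : Distinct p Q)
    (hdisk : DiskSD p Q) (R : Region) {A G : ℕ → ℕ → Dbl} {B : ℕ → ℕ → MvPolynomial (Fin 2) ℂ}
    {a b : ℕ} (ha : a < p) (hb : b < p)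
    (hA : A a b = ∑ s ∈ Finset.Icc 1 p, ∑ t ∈ Finset.Icc 1 p,
      at1Hom R (lagr p Q a s) * at2Hom R (lagr p Q b t) * G s t)
    (hG : ∀ s ∈ Finset.Icc 1 p, ∀ t ∈ Finset.Icc 1 p, zdiff p R ^ 2 * G s t =
      (p : Dbl)⁻¹ * at1Hom R (toSer (sa p Q (s - 1))) * at2Hom R (toSer (sa p Q (t - 1))) +
        evalHom R p (B s t)) :
    A a b = toDbl (ampF R p Q B a b) / zdiff p R ^ 2 *
      ((∏ i ∈ (Finset.range p).erase a, (at1Hom R (Q a - Q i))⁻¹) *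
        ∏ j ∈ (Finset.range p).erase b, (at2Hom R (Q b - Q j))⁻¹) := by
  have hz := pow_ne_zero 2 (zdiff_ne_zero hp R)
  have hne : ∀ a < p, ∏ i ∈ (Finset.range p).erase a, (Q a - Q i) ≠ 0 :=
    fun a ha => prod_sub_ne_zero h ha
  have hPa := (map_ne_zero (at1Hom R)).2 (hne a ha)
  have hPb := (map_ne_zero (at2Hom R)).2 (hne b hb)
  -- The exponents p - s, p - t and s + t add up to the even number 2p.
  have hsign : ∀ s ∈ Finset.Icc 1 p, ∀ t ∈ Finset.Icc 1 p,
      (-1 : Dbl) ^ (s + t) = (-1) ^ (p - s) * (-1) ^ (p - t) := by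
    intro s hs t ht
    rw [Finset.mem_Icc] at hs ht
    have e : (p - s) + (p - t) + (s + t) = 2 * p := by omega
    have e1 : (-1 : Dbl) ^ (p - s) * (-1) ^ (p - t) * (-1) ^ (s + t) = 1 := by
      rw [← pow_add, ← pow_add, e, pow_mul]; simp
    have e2 : (-1 : Dbl) ^ (s + t) * (-1) ^ (s + t) = 1 := by
      rw [← mul_pow]; simp
    linear_combination (-(-1 : Dbl) ^ (s + t)) * e1 + ((-1 : Dbl) ^ (p - s) * (-1) ^ (p - t)) * e2
  rw [Finset.prod_inv_distrib, Finset.prod_inv_distrib, ← map_prod, ← map_prod, toDbl_ampF,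
    toSer_curveF' Q ha, toSer_curveF' Q hb]
  -- ∂F/∂Q at `Q_a` is the denominator of the Lagrange coefficients of sheet a; factoring it out for
  -- both variables turns the σ-sum into a sum over Lagrange coefficients.
  have hl : ∀ s ∈ Finset.Icc 1 p, ∀ t ∈ Finset.Icc 1 p,
      (-1) ^ (s + t) * at1Hom R (toSer (sigma p Q a (p - s))) *
        at2Hom R (toSer (sigma p Q b (p - t))) * evalHom R p (B s t) =
      at1Hom R (∏ i ∈ (Finset.range p).erase a, (Q a - Q i)) *
        at2Hom R (∏ i ∈ (Finset.range p).erase b, (Q b - Q i)) *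
        (at1Hom R (lagr p Q a s) * at2Hom R (lagr p Q b t) * evalHom R p (B s t)) := by
    intro s hs t ht
    rw [hsign s hs t ht, lagr_eq, lagr_eq]
    simp only [map_mul (at1Hom R), map_mul (at2Hom R), map_inv₀, map_pow (at1Hom R),
      map_pow (at2Hom R), map_neg, map_one]
    have e1 := mul_inv_cancel₀ hPa
    have e2 := mul_inv_cancel₀ hPb
    generalize at1Hom R (∏ i ∈ (Finset.range p).erase a, (Q a - Q i)) = x at *
    generalize at2Hom R (∏ i ∈ (Finset.range p).erase b, (Q b - Q i)) = y at *
    generalize at1Hom R (toSer (sigma p Q a (p - s))) = σ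
    generalize at2Hom R (toSer (sigma p Q b (p - t))) = τ
    field_simp
  rw [Finset.sum_congr rfl fun s hs => Finset.sum_congr rfl fun t ht => hl s hs t ht]
  simp only [← Finset.mul_sum]
  -- After inversion the product of disk terms collapses to 1/p, and only B_st keeps its sum.
  have hsum : zdiff p R ^ 2 * A a b = (p : Dbl)⁻¹ +
      ∑ s ∈ Finset.Icc 1 p, ∑ t ∈ Finset.Icc 1 p,
        at1Hom R (lagr p Q a s) * at2Hom R (lagr p Q b t) * evalHom R p (B s t) := by
    have e1 : ∀ s ∈ Finset.Icc 1 p, ∀ t ∈ Finset.Icc 1 p,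
        zdiff p R ^ 2 * (at1Hom R (lagr p Q a s) * at2Hom R (lagr p Q b t) * G s t) =
        (p : Dbl)⁻¹ * (at1Hom R (lagr p Q a s * toSer (sa p Q (s - 1))) *
          at2Hom R (lagr p Q b t * toSer (sa p Q (t - 1)))) +
        at1Hom R (lagr p Q a s) * at2Hom R (lagr p Q b t) * evalHom R p (B s t) := by
      intro s hs t ht
      rw [map_mul, map_mul]
      linear_combination (at1Hom R (lagr p Q a s) * at2Hom R (lagr p Q b t)) * hG s hs t ht
    rw [hA]
    simp only [Finset.mul_sum]
    rw [Finset.sum_congr rfl fun s hs => Finset.sum_congr rfl fun t ht => e1 s hs t ht]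
    simp only [Finset.sum_add_distrib, ← Finset.mul_sum, ← Finset.sum_mul]
    rw [← map_sum, ← map_sum, sum_lagr_mul_sa h hdisk ha, sum_lagr_mul_sa h hdisk hb, map_one,
      map_one, mul_one, mul_one]
  generalize (∑ s ∈ Finset.Icc 1 p, ∑ t ∈ Finset.Icc 1 p,
        at1Hom R (lagr p Q a s) * at2Hom R (lagr p Q b t) * evalHom R p (B s t)) = T at *
  generalize at1Hom R (∏ i ∈ (Finset.range p).erase a, (Q a - Q i)) = x at *
  generalize at2Hom R (∏ i ∈ (Finset.range p).erase b, (Q b - Q i)) = y at *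
  generalize (p : Dbl)⁻¹ = u at *
  have : A a b = (u + T) / zdiff p R ^ 2 := by
    rw [eq_div_iff hz, ← hsum]; ring
  rw [this]
  generalize zdiff p R ^ 2 = z at *
  field_simp

theorem exists_annulus_structure {p : ℕ} (hp : 0 < p) {Q : ℕ → Ser}
    (hQ : ∀ a, Q a = tw1 (om p ^ a) (Q 0)) (hdist : Distinct p Q) (hdisk : DiskSD p Q) :
    ∃ BN : ℕ → ℕ → MvPolynomial (Fin 2) ℂ, ∀ w : ℕ → ℕ → ℂ,
      (∀ s t : ℕ, 1 ≤ s → 1 ≤ t → AnnulusSD p Q w s t) →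
      ∃ GA B : ℕ → ℕ → MvPolynomial (Fin 2) ℂ, ∀ R : Region,
        (∀ s ∈ Finset.Icc 1 p, ∀ t ∈ Finset.Icc 1 p,
          B s t = BN s t + (MvPolynomial.X 0 - MvPolynomial.X 1) ^ 2 * GA s t ∧
          evalZeta R p (GA s t) = ampGA R p Q w s t ∧
          ampG R p Q w s t = 1 / (zeta1 R p - zeta2 R p) ^ 2 *
            ((p : Double)⁻¹ * at1 R (sa p Q (s - 1)) * at2 R (sa p Q (t - 1)) +
              evalZeta R p (B s t))) ∧
        (∀ a < p, ∀ b < p,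
          ampA R p w a b = ampF R p Q B a b / (zeta1 R p - zeta2 R p) ^ 2 *
            ((∏ i ∈ (Finset.range p).erase a, (at1 R (Q a - Q i))⁻¹) *
              ∏ j ∈ (Finset.range p).erase b, (at2 R (Q b - Q j))⁻¹)) := by
  choose BN hBN using exists_universal_polynomial hp hQ
  refine ⟨BN, fun w hw => ?_⟩
  choose GA hGA using exists_polynomial_ampGA hp Q w
  let B : ℕ → ℕ → MvPolynomial (Fin 2) ℂ := fun s t =>
    BN s t + (MvPolynomial.X 0 - MvPolynomial.X 1) ^ 2 * GA s t
  have hX : ∀ R, evalHom R p (MvPolynomial.X 0 - MvPolynomial.X 1) = zdiff p R := fun R => by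
    rw [map_sub]
    simp [evalHom, zdiff]
  have hB : ∀ R, ∀ s ∈ Finset.Icc 1 p, ∀ t ∈ Finset.Icc 1 p,
      zdiff p R ^ 2 * toDbl (ampG R p Q w s t) =
      (p : Dbl)⁻¹ * at1Hom R (toSer (sa p Q (s - 1))) * at2Hom R (toSer (sa p Q (t - 1))) +
        evalHom R p (B s t) := by
    intro R s hs t ht
    have h1 := hw s t (Finset.mem_Icc.1 hs).1 (Finset.mem_Icc.1 ht).1
    have h2 := (annulusSD_iff hp hQ w s t).1 h1
    -- Under (SD) the sheet sum and G_st coincide, so the polynomial identity for the former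
    -- transfers to the latter.
    rw [map_add, map_mul, map_pow, hX, hGA, ← hBN s t w h2 R, ampPairing,
      (pairing_eq_ampG_iff hp hQ s t).2 (h2 R)]
  have hzz : ∀ R, zdiff p R = toDbl (zeta1 R p - zeta2 R p) := fun R => by
    rw [zdiff, ← zeta1_eq, ← zeta2_eq]
    rfl
  refine ⟨GA, B, fun R => ⟨fun s hs t ht => ⟨rfl, ?_, ?_⟩, fun a ha b hb => ?_⟩⟩
  · exact (evalZeta_eq R p _).trans (hGA s t R)
  · have hz := pow_ne_zero 2 (zdiff_ne_zero hp R)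
    have h1 : toDbl (ampG R p Q w s t) = 1 / zdiff p R ^ 2 *
        ((p : Dbl)⁻¹ * at1Hom R (toSer (sa p Q (s - 1))) * at2Hom R (toSer (sa p Q (t - 1))) +
          evalHom R p (B s t)) := by
      rw [← hB R s hs t ht, ← mul_assoc, one_div, inv_mul_cancel₀ hz, one_mul]
    rw [hzz, ← at1_eq_hom, ← at2_eq_hom, ← evalZeta_eq] at h1
    exact h1
  · have h1 := (annulusSD_tfae hp hQ hdist hdisk w).out 0 1
    have h2 := (sheetSum_eq_iff hdist R (ampA R p w) (ampG R p Q w)).1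
      (fun s hs t ht => h1.1 hw s hs t ht R) a ha b hb
    have h3 := inversion_eq hdist R (ampG R p Q w) ha hb
    have h4 := amplitude_eq_ampF hp hdist hdisk R (A := fun a b => toDbl (ampA R p w a b))
      (G := fun s t => toDbl (ampG R p Q w s t)) (B := B) ha hb
      ((congrArg toDbl h2).trans h3) (hB R)
    rw [hzz] at h4
    simp only [← at1_eq_hom, ← at2_eq_hom] at h4
    exact h4

end Annulus

theorem theorem7 (p q : ℕ) (hp : 0 < p) (hpq : Nat.Coprime p q) (b v : ℕ → ℂ)
    (hb : b (p + q) ≠ 0) (Q : ℕ → Annulus.Series) (hQ : Q = Annulus.diskQ p q b v)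
    (hdisk : Annulus.DiskSD p Q) :
    -- the linear system in `A` is solved, for any right-hand side, by the inversion formula
    (∀ (R : Annulus.Region) (A G : ℕ → ℕ → Annulus.Double),
      (∀ s ∈ Finset.Icc 1 p, ∀ t ∈ Finset.Icc 1 p, Annulus.sheetSum R p Q A s t = G s t) ↔
        ∀ a < p, ∀ b < p, A a b = Annulus.inversion R p Q G a b) ∧
    -- the Schwinger–Dyson equations are solved by it, and the first `p` values suffice
    (∀ w : ℕ → ℕ → ℂ, List.TFAE [
      ∀ s t : ℕ, 1 ≤ s → 1 ≤ t → Annulus.AnnulusSD p Q w s t,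
      ∀ s ∈ Finset.Icc 1 p, ∀ t ∈ Finset.Icc 1 p, Annulus.AnnulusSD p Q w s t,
      ∀ R : Annulus.Region, ∀ a < p, ∀ b < p,
        Annulus.conn R p w a b =
          Annulus.inversion R p Q (Annulus.ampG R p Q w) a b - Annulus.deltaPart R p a b]) ∧
    -- structure of the solutions: `B = B^N + (ζ₁ - ζ₂)² G^A`, where `B^N` depends on the
    -- disk amplitudes only
    ∃ BN : ℕ → ℕ → MvPolynomial (Fin 2) ℂ, ∀ w : ℕ → ℕ → ℂ,
      (∀ s t : ℕ, 1 ≤ s → 1 ≤ t → Annulus.AnnulusSD p Q w s t) →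
      ∃ GA B : ℕ → ℕ → MvPolynomial (Fin 2) ℂ, ∀ R : Annulus.Region,
        (∀ s ∈ Finset.Icc 1 p, ∀ t ∈ Finset.Icc 1 p,
          B s t = BN s t + (MvPolynomial.X 0 - MvPolynomial.X 1) ^ 2 * GA s t ∧
          Annulus.evalZeta R p (GA s t) = Annulus.ampGA R p Q w s t ∧
          Annulus.ampG R p Q w s t =
            1 / (Annulus.zeta1 R p - Annulus.zeta2 R p) ^ 2 *
              ((p : Annulus.Double)⁻¹ * Annulus.at1 R (Annulus.sa p Q (s - 1)) *
                  Annulus.at2 R (Annulus.sa p Q (t - 1)) +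
                Annulus.evalZeta R p (B s t))) ∧
        (∀ a < p, ∀ b < p,
          Annulus.ampA R p w a b =
            Annulus.ampF R p Q B a b / (Annulus.zeta1 R p - Annulus.zeta2 R p) ^ 2 *
              ((∏ i ∈ (Finset.range p).erase a, (Annulus.at1 R (Q a - Q i))⁻¹) *
                ∏ j ∈ (Finset.range p).erase b, (Annulus.at2 R (Q b - Q j))⁻¹))
        
    := by
  subst hQ
  -- Besides the disk equations, only two properties of the disk amplitude are used: its sheets are
  -- rotations of one another, and they are distinct.
  have htw : ∀ a, Annulus.toSer (Annulus.diskQ p q b v a) =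
      Annulus.tw1 (Annulus.om p ^ a) (Annulus.toSer (Annulus.diskQ p q b v 0)) :=
    Annulus.diskQ_eq_tw1 hp q b v
  have hdist := Annulus.diskQ_distinct hp hpq hb v
  exact ⟨fun R A G => Annulus.sheetSum_eq_iff hdist R A G,
    fun w => Annulus.annulusSD_tfae hp htw hdist hdisk w,
    Annulus.exists_annulus_structure hp htw hdist hdisk⟩
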